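/- Let $\mathbf C$ be a cubical $\omega$-category with connections (in the sense of Al-Agl, Brown and Steiner), with faces $\partial_i^\alpha$, degeneracies $\epsilon_i$, connections $\Gamma_i^\alpha$ ($\alpha=\pm$) and partial compositions $\star_i$, where $A\star_i B$ is defined exactly when $\partial_i^+A=\partial_i^-B$. Definitions. Let $n>0$ and $A\in\mathbf C_n$. - For $1\le k\le n$, $A$ is *$R_k$-invertible* if there is $B\in\mathbf C_n$ such that $A\star_k B=\epsilon_k\partial_k^-A$ and $B\star_k A=\epsilon_k\partial_k^+A$ (both composites being defined). - For $1\le i<n$, $A$ is *$T_i$-invertible* if there is $B\in\mathbf C_n$ with $\partial_i^\alpha A=\partial_{i+1}^\alpha B$ and $\partial_{i+1}^\alpha A=\partial_i^\alpha B$ for $\alpha=\pm$, such that $$(\Gamma_i^+\partial_{i+1}^-A\star_i B)\star_{i+1}(A\star_i\Gamma_i^-\partial_i^+A)=\Gamma_i^-\partial_i^-A\star_i\Gamma_i^+\partial_{i+1}^+A$$ and the same equation holds with $A$ and $B$ exchanged. - Let $\Box_{n-1}\mathbf C$ be the cubical $n$-category which coincides with $\mathbf C$ in dimensions $<n$ and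 whose $n$-cells are the families $(A_i^\alpha)_{1\le i\le n,\,\alpha=\pm}$ of $(n-1)$-cells of $\mathbf C$ satisfying $\partial_i^\alpha A_j^\beta=\partial_{j-1}^\beta A_i^\alpha$ for $i<j$, with faces $\partial_i^\alpha A=A_i^\alpha$, with $\epsilon_i x$ and $\Gamma_i^\alpha x$ the families of faces of the cells $\epsilon_i x$ and $\Gamma_i^\alpha x$ of $\mathbf C$, and with composites given by $(A\star_i B)_i^-=A_i^-$, $(A\star_i B)_i^+=B_i^+$, $(A\star_i B)_j^\alpha=A_j^\alpha\star_{i-1}B_j^\alpha$ for $j<i$ and $(A\star_i B)_j^\alpha=A_j^\alpha\star_{i}B_j^\alpha$ for $j>i$. The *shell* of $A\in\mathbf C_n$ is the family $(\partial_i^\alpha A)$. One says that $A$ *has an $R_k$-invertible* (resp. *$T_i$-invertible*) *shell* if its shell is $R_k$-invertible (resp. $T_i$-invertible) in $\Box_{n-1}\mathbf C$. - The folding operations on $\mathbf C_n$ are $\psi_iA=\Gamma_i^+\partial_{i+1}^-A\star_{i+1}A\star_{i+1}\Gamma_i^-\partial_{i+1}^+A$ for $1\le i<n$, $\Psi_r=\psi_{r-1}\cdots\psi_1$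 for $1\le r\le n$, and $\Phi_m=\Psi_1\cdots\Psi_m$ for $0\le m\le n$ (products are composites of maps, the rightmost map being applied first). - $A$ is *invertible* if $\psi_1\cdots\psi_{n-1}A$ is $R_1$-invertible. Proposition. For every $n>0$, the following are equivalent: 1. every $n$-cell of $\mathbf C$ is invertible; 2. for all $1\le i\le n$, every $n$-cell of $\mathbf C$ with an $R_i$-invertible shell is $R_i$-invertible; 3. every $n$-cell of $\mathbf C$ with an $R_1$-invertible shell is $R_1$-invertible; 4. every $A\in\mathbf C_n$ such that $\partial_j^\alpha A\in\operatorname{im}\epsilon_1$ for all $j\ne1$ and $\alpha=\pm$ is $R_1$-invertible; 5. every $n$-cell in $\Phi_n(\mathbf C_n)$ is $R_1$-invertible. If moreover $n>1$, these properties are also equivalent to each of the following: 6. for all $1\le i<n$, every $n$-cell of $\mathbf C$ with a $T_i$-invertible shell is $T_i$-invertible; 7. every $n$-cell of $\mathbf C$ with a $T_1$-invertible shell is $T_1$-invertible. -/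

import Mathlib

universe u

/-!
Conventions.  Signs are Booleans: `false` stands for `-` and `true` for `+`.  Indices are
`0`-based: the operation written `∂_i`, `ε_i`, `Γ_i`, `⋆_i`, `ψ_i` with `1 ≤ i` in the usual
notation is the one with index `i - 1` here.  Composites of operations are read as composites of
functions (the rightmost one is applied first).
-/

/-- A cubical `ω`-category (with connections), in the sense of Al-Agl, Brown and Steiner:
a cubical set with connections and partial compositions `⋆_i`, where `a ⋆_i b` is defined exactly
when `∂_i^+ a = ∂_i^- b`.  An equation between composites is required whenever both of its sides
are defined (all composability hypotheses are universally quantified). -/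
structure CubicalOmegaCat where
  /-- the set of `n`-cells -/
  cells : ℕ → Type u
  /-- `∂_i^α : C_{n+1} → C_n`, for `1 ≤ i ≤ n + 1` -/
  face : {n : ℕ} → Fin (n + 1) → Bool → cells (n + 1) → cells n
  /-- `ε_i : C_n → C_{n+1}`, for `1 ≤ i ≤ n + 1` -/
  deg : {n : ℕ} → Fin (n + 1) → cells n → cells (n + 1)
  /-- `Γ_i^α : C_n → C_{n+1}`, for `1 ≤ i ≤ n` -/
  conn : {n : ℕ} → Fin n → Bool → cells n → cells (n + 1)
  /-- `a ⋆_i b` for `a b : C_{n+1}` with `∂_i^+ a = ∂_i^- b` and `1 ≤ i ≤ n + 1` -/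
  comp : {n : ℕ} → (i : Fin (n + 1)) → (a b : cells (n + 1)) →
    face i true a = face i false b → cells (n + 1)
  -- cubical set
  face_face : ∀ {n : ℕ} (i j : Fin (n + 1)) (α β : Bool) (x : cells (n + 2)), i ≤ j →
    face i α (face j.succ β x) = face j β (face i.castSucc α x)
  deg_deg : ∀ {n : ℕ} (i j : Fin (n + 1)) (x : cells n), i ≤ j →
    deg i.castSucc (deg j x) = deg j.succ (deg i x)
  face_deg_self : ∀ {n : ℕ} (i : Fin (n + 1)) (α : Bool) (x : cells n),
    face i α (deg i x) = x
  face_deg_lt : ∀ {n : ℕ} (i j : Fin (n + 1)) (α : Bool) (x : cells (n + 1)), i ≤ j →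
    face i.castSucc α (deg j.succ x) = deg j (face i α x)
  face_deg_gt : ∀ {n : ℕ} (i j : Fin (n + 1)) (α : Bool) (x : cells (n + 1)), j ≤ i →
    face i.succ α (deg j.castSucc x) = deg j (face i α x)
  -- connections
  face_conn_castSucc : ∀ {n : ℕ} (j : Fin n) (α : Bool) (x : cells n),
    face j.castSucc α (conn j α x) = x
  face_conn_succ : ∀ {n : ℕ} (j : Fin n) (α : Bool) (x : cells n),
    face j.succ α (conn j α x) = x
  face_conn_castSucc_not : ∀ {n : ℕ} (j : Fin (n + 1)) (α : Bool) (x : cells (n + 1)),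
    face j.castSucc α (conn j (!α) x) = deg j (face j α x)
  face_conn_succ_not : ∀ {n : ℕ} (j : Fin (n + 1)) (α : Bool) (x : cells (n + 1)),
    face j.succ α (conn j (!α) x) = deg j (face j α x)
  face_conn_lt : ∀ {n : ℕ} (i j : Fin (n + 1)) (α β : Bool) (x : cells (n + 2)), i ≤ j →
    face i.castSucc.castSucc α (conn j.succ β x) = conn j β (face i.castSucc α x)
  face_conn_gt : ∀ {n : ℕ} (i j : Fin (n + 1)) (α β : Bool) (x : cells (n + 2)), j ≤ i →
    face i.succ.succ α (conn j.castSucc β x) = conn j β (face i.succ α x)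
  conn_conn_lt : ∀ {n : ℕ} (i j : Fin n) (α β : Bool) (x : cells n), i < j →
    conn i.castSucc α (conn j β x) = conn j.succ β (conn i α x)
  conn_conn_self : ∀ {n : ℕ} (i : Fin n) (α : Bool) (x : cells n),
    conn i.castSucc α (conn i α x) = conn i.succ α (conn i α x)
  conn_deg_lt : ∀ {n : ℕ} (i j : Fin n) (α : Bool) (x : cells n), i ≤ j →
    conn i.castSucc α (deg j.succ x) = deg j.succ.succ (conn i α x)
  conn_deg_gt : ∀ {n : ℕ} (i j : Fin n) (α : Bool) (x : cells n), j ≤ i →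
    conn i.succ α (deg j.castSucc x) = deg j.castSucc.castSucc (conn i α x)
  conn_deg_self : ∀ {n : ℕ} (i : Fin (n + 1)) (α : Bool) (x : cells n),
    conn i α (deg i x) = deg i.castSucc (deg i x)
  -- faces, degeneracies and connections of composites
  face_comp_minus : ∀ {n : ℕ} (i : Fin (n + 1)) (a b : cells (n + 1))
    (h : face i true a = face i false b), face i false (comp i a b h) = face i false a
  face_comp_plus : ∀ {n : ℕ} (i : Fin (n + 1)) (a b : cells (n + 1))
    (h : face i true a = face i false b), face i true (comp i a b h) = face i true b
  face_comp_lt : ∀ {n : ℕ} (i j : Fin (n + 1)) (α : Bool) (a b : cells (n + 2)), i ≤ j → ∀ h h',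
    face i.castSucc α (comp j.succ a b h)
      = comp j (face i.castSucc α a) (face i.castSucc α b) h'
  face_comp_gt : ∀ {n : ℕ} (i j : Fin (n + 1)) (α : Bool) (a b : cells (n + 2)), j ≤ i → ∀ h h',
    face i.succ α (comp j.castSucc a b h) = comp j (face i.succ α a) (face i.succ α b) h'
  deg_comp : ∀ {n : ℕ} (i : Fin (n + 2)) (j : Fin (n + 1)) (a b : cells (n + 1)), ∀ h h',
    deg i (comp j a b h) = comp (i.succAbove j) (deg i a) (deg i b) h'
  conn_comp_lt : ∀ {n : ℕ} (i j : Fin (n + 1)) (α : Bool) (a b : cells (n + 1)), i < j → ∀ h h',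
    conn i α (comp j a b h) = comp j.succ (conn i α a) (conn i α b) h'
  conn_comp_gt : ∀ {n : ℕ} (i j : Fin (n + 1)) (α : Bool) (a b : cells (n + 1)), j < i → ∀ h h',
    conn i α (comp j a b h) = comp j.castSucc (conn i α a) (conn i α b) h'
  conn_minus_comp : ∀ {n : ℕ} (i : Fin (n + 1)) (a b : cells (n + 1)), ∀ h h₁ h₂ h₃,
    conn i false (comp i a b h) =
      comp i.succ
        (comp i.castSucc (conn i false a) (deg i.succ b) h₁)
        (comp i.castSucc (deg i.castSucc b) (conn i false b) h₂) h₃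
  conn_plus_comp : ∀ {n : ℕ} (i : Fin (n + 1)) (a b : cells (n + 1)), ∀ h h₁ h₂ h₃,
    conn i true (comp i a b h) =
      comp i.succ
        (comp i.castSucc (conn i true a) (deg i.castSucc a) h₁)
        (comp i.castSucc (deg i.succ a) (conn i true b) h₂) h₃
  -- units, associativity, interchange, cancellation of connections
  comp_deg : ∀ {n : ℕ} (i : Fin (n + 1)) (a : cells (n + 1)), ∀ h,
    comp i a (deg i (face i true a)) h = a
  deg_comp_self : ∀ {n : ℕ} (i : Fin (n + 1)) (a : cells (n + 1)), ∀ h,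
    comp i (deg i (face i false a)) a h = a
  comp_assoc : ∀ {n : ℕ} (i : Fin (n + 1)) (a b c : cells (n + 1)), ∀ h₁ h₂ h₃ h₄,
    comp i a (comp i b c h₁) h₂ = comp i (comp i a b h₃) c h₄
  interchange : ∀ {n : ℕ} (i j : Fin (n + 1)) (a b c d : cells (n + 1)), i ≠ j →
    ∀ h₁ h₂ h₃ h₄ h₅ h₆,
    comp j (comp i a b h₁) (comp i c d h₂) h₃ = comp i (comp j a c h₄) (comp j b d h₅) h₆
  conn_comp_conn_castSucc : ∀ {n : ℕ} (i : Fin n) (a : cells n), ∀ h,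
    comp i.castSucc (conn i true a) (conn i false a) h = deg i.succ a
  conn_comp_conn_succ : ∀ {n : ℕ} (i : Fin n) (a : cells n), ∀ h,
    comp i.succ (conn i true a) (conn i false a) h = deg i.castSucc a

/-- The operations relating the cells of dimension `n` (`lower`) and `n + 1` (`upper`) in a cubical
category of dimension at least `n + 1`.  Invertibility of an `(n + 1)`-cell only involves these. -/
structure CubicalLevel (n : ℕ) where
  lower : Type u
  upper : Type u
  face : Fin (n + 1) → Bool → upper → lower
  deg : Fin (n + 1) → lower → upper
  conn : Fin n → Bool → lower → upper
  comp : (i : Fin (n + 1)) → (a b : upper) → face i true a = face i false b → upper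

namespace CubicalLevel

variable {n : ℕ} (L : CubicalLevel.{u} n)

/-- `A` is `R_k`-invertible: there is `B` with `A ⋆_k B = ε_k ∂_k^- A` and
`B ⋆_k A = ε_k ∂_k^+ A` (the composites being defined). -/
def RInvertible (k : Fin (n + 1)) (A : L.upper) : Prop :=
  ∃ (B : L.upper) (h : L.face k true A = L.face k false B)
    (h' : L.face k true B = L.face k false A),
    L.comp k A B h = L.deg k (L.face k false A) ∧
    L.comp k B A h' = L.deg k (L.face k true A)

/-- The equation
`(Γ_i^+ ∂_{i+1}^- A ⋆_i B) ⋆_{i+1} (A ⋆_i Γ_i^- ∂_i^+ A) = Γ_i^- ∂_i^- A ⋆_i Γ_i^+ ∂_{i+1}^+ A`,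
with all the composites defined. -/
def TEquation (i : Fin n) (A B : L.upper) : Prop :=
  ∃ h₁ h₂ h₃ h₄,
    L.comp i.succ
      (L.comp i.castSucc (L.conn i true (L.face i.succ false A)) B h₁)
      (L.comp i.castSucc A (L.conn i false (L.face i.castSucc true A)) h₂) h₃ =
    L.comp i.castSucc (L.conn i false (L.face i.castSucc false A))
      (L.conn i true (L.face i.succ true A)) h₄

/-- `A` is `T_i`-invertible: there is `B` whose faces in directions `i` and `i + 1` are those of
`A` exchanged, and such that the two defining equations of a `T_i`-inverse hold. -/
def TInvertible (i : Fin n) (A : L.upper) : Prop :=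
  ∃ B : L.upper,
    (∀ α, L.face i.castSucc α A = L.face i.succ α B ∧
      L.face i.succ α A = L.face i.castSucc α B) ∧
    L.TEquation i A B ∧ L.TEquation i B A

end CubicalLevel

namespace CubicalOmegaCat

variable (C : CubicalOmegaCat.{u})

/-- The cells of dimensions `n` and `n + 1` of `C`. -/
def level (n : ℕ) : CubicalLevel.{u} n where
  lower := C.cells n
  upper := C.cells (n + 1)
  face := C.face
  deg := C.deg
  conn := C.conn
  comp := C.comp

/-- The compatibility condition `∂_i^α A_j^β = ∂_{j-1}^β A_i^α` (`i < j`) on a family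
`A_i^α` of `n`-cells (`1 ≤ i ≤ n + 1`). -/
def IsShell : {n : ℕ} → (Fin (n + 1) → Bool → C.cells n) → Prop
  | 0, _ => True
  | _ + 1, A => ∀ i j α β, i ≤ j → C.face i α (A j.succ β) = C.face j β (A i.castSucc α)

/-- The `(n + 1)`-cells of `□_n C`: compatible families of `n`-cells of `C`. -/
def Shell (n : ℕ) : Type u := {A : Fin (n + 1) → Bool → C.cells n // C.IsShell A}

/-- The shell `(∂_i^α x)` of an `(n + 1)`-cell `x`. -/
def shell {n : ℕ} (x : C.cells (n + 1)) : C.Shell n :=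
  ⟨fun i α => C.face i α x, by
    cases n with
    | zero => trivial
    | succ n => exact fun i j α β h => C.face_face i j α β x h⟩

/-- The family `(A ⋆_c B)_j^α`: it is `A_c^-` or `B_c^+` for `j = c`, and for `j ≠ c` it is
the composite of `A_j^α` and `B_j^α` in direction `c - 1` (if `j < c`) or `c` (if `c < j`). -/
def shellCompFamily : {n : ℕ} → (c : Fin (n + 1)) → (A B : C.Shell n) →
    A.1 c true = B.1 c false → Fin (n + 1) → Bool → C.cells n
  | 0, c, A, B, _, _, α => match α with
    | false => A.1 c false
    | true => B.1 c true
  | n + 1, c, A, B, h, j, α =>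
    if hj : j < c then
      C.comp (c.pred (Fin.ne_zero_of_lt hj)) (A.1 j α) (B.1 j α) (by
        obtain ⟨c, rfl⟩ := Fin.exists_succ_eq.2 (Fin.ne_zero_of_lt hj)
        obtain ⟨j, rfl⟩ := Fin.exists_castSucc_eq.2 (Fin.ne_last_of_lt hj)
        have hjc : j ≤ c := Fin.castSucc_lt_succ_iff.1 hj
        rw [Fin.pred_succ, ← A.2 j c α true hjc, ← B.2 j c α false hjc, h])
    else if hc : c < j then
      C.comp (c.castPred (Fin.ne_last_of_lt hc)) (A.1 j α) (B.1 j α) (by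
        obtain ⟨j, rfl⟩ := Fin.exists_succ_eq.2 (Fin.ne_zero_of_lt hc)
        obtain ⟨c, rfl⟩ := Fin.exists_castSucc_eq.2 (Fin.ne_last_of_lt hc)
        have hcj : c ≤ j := Fin.castSucc_lt_succ_iff.1 hc
        rw [Fin.castPred_castSucc, A.2 c j true α hcj, B.2 c j false α hcj, h])
    else match α with
      | false => A.1 c false
      | true => B.1 c true

theorem face_composable_lt {n : ℕ} (i j : Fin (n + 1)) (α : Bool) (a b : C.cells (n + 2))
    (hij : i ≤ j) (h : C.face j.succ true a = C.face j.succ false b) :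
    C.face j true (C.face i.castSucc α a) = C.face j false (C.face i.castSucc α b) := by
  rw [← C.face_face i j α true a hij, ← C.face_face i j α false b hij, h]

theorem face_composable_gt {n : ℕ} (i j : Fin (n + 1)) (α : Bool) (a b : C.cells (n + 2))
    (hji : j ≤ i) (h : C.face j.castSucc true a = C.face j.castSucc false b) :
    C.face j true (C.face i.succ α a) = C.face j false (C.face i.succ α b) := by
  rw [C.face_face j i true α a hji, C.face_face j i false α b hji, h]

theorem isShell_shellCompFamily {n : ℕ} (c : Fin (n + 1)) (A B : C.Shell n)
    (h : A.1 c true = B.1 c false) : C.IsShell (C.shellCompFamily c A B h) := by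
  cases n with
  | zero => trivial
  | succ n =>
  have key : ∀ {k : ℕ} (i : Fin (k + 1)) (a b a' b' : C.cells (k + 1)) (h₁) (h₂),
      a = a' → b = b' → C.comp i a b h₁ = C.comp i a' b' h₂ := by
    rintro k i a b _ _ h₁ h₂ rfl rfl
    rfl
  have hlt : ∀ (j : Fin (n + 2)) (d : Fin (n + 1)) (α : Bool) (_ : j.val ≤ d.val)
      (_ : c = d.succ), ∃ h', C.shellCompFamily c A B h j α = C.comp d (A.1 j α) (B.1 j α) h' := by
    rintro j d α hj rfl
    have hj' : j < d.succ := Nat.lt_succ_of_le hj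
    simp only [shellCompFamily, dif_pos hj', Fin.pred_succ, exists_prop, and_true]
    obtain ⟨j, rfl⟩ := Fin.exists_castSucc_eq.2 (Fin.ne_last_of_lt hj')
    have hjd : j ≤ d := Fin.castSucc_lt_succ_iff.1 hj'
    rw [← A.2 j d α true hjd, ← B.2 j d α false hjd, h]
  have hgt : ∀ (j : Fin (n + 2)) (d : Fin (n + 1)) (α : Bool) (_ : d.val < j.val)
      (_ : c = d.castSucc),
      ∃ h', C.shellCompFamily c A B h j α = C.comp d (A.1 j α) (B.1 j α) h' := by
    rintro j d α hj rfl
    have hj' : d.castSucc < j := hj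
    simp only [shellCompFamily, dif_neg hj'.not_gt, dif_pos hj', Fin.castPred_castSucc,
      exists_prop, and_true]
    obtain ⟨j, rfl⟩ := Fin.exists_succ_eq.2 (Fin.ne_zero_of_lt hj')
    have hdj : d ≤ j := Fin.castSucc_lt_succ_iff.1 hj'
    rw [A.2 d j true α hdj, B.2 d j false α hdj, h]
  have hself : ∀ (α : Bool), C.shellCompFamily c A B h c α =
      match α with
      | false => A.1 c false
      | true => B.1 c true := by
    intro α
    simp only [shellCompFamily, lt_irrefl, dite_false]
  intro i j α β hij
  have hij' : i.val ≤ j.val := hij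
  have hjn := j.isLt
  by_cases hci : c = i.castSucc
  · subst hci
    obtain ⟨h₁, e₁⟩ := hgt j.succ i β (Nat.lt_succ_of_le hij') rfl
    rw [e₁, hself]
    cases α
    · rw [C.face_comp_minus]; exact A.2 _ _ _ _ hij
    · rw [C.face_comp_plus]; exact B.2 _ _ _ _ hij
  by_cases hcj : c = j.succ
  · subst hcj
    obtain ⟨h₁, e₁⟩ := hlt i.castSucc j α hij' rfl
    rw [e₁, hself]
    cases β
    · rw [C.face_comp_minus]; exact A.2 _ _ _ _ hij
    · rw [C.face_comp_plus]; exact B.2 _ _ _ _ hij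
  have hci' : c.val ≠ i.val := fun e => hci (Fin.ext e)
  have hcj' : c.val ≠ j.val + 1 := fun e => hcj (Fin.ext e)
  have hcn := c.isLt
  cases n with
  | zero => omega
  | succ n =>
  rcases Nat.lt_or_gt_of_ne hci' with hlti | hgti
  · -- `c` is below both indices
    obtain ⟨d, rfl⟩ : ∃ d : Fin (n + 1), c = d.castSucc.castSucc := ⟨⟨c, by omega⟩, rfl⟩
    obtain ⟨i, rfl⟩ : ∃ k : Fin (n + 1), i = k.succ :=
      ⟨⟨i - 1, by omega⟩, Fin.ext (by simp only [Fin.val_succ]; omega)⟩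
    obtain ⟨j, rfl⟩ : ∃ k : Fin (n + 1), j = k.succ :=
      ⟨⟨j - 1, by omega⟩, Fin.ext (by simp only [Fin.val_succ]; omega)⟩
    simp only [Fin.val_castSucc, Fin.val_succ] at *
    have hdi : d ≤ i := Fin.le_def.2 (by omega)
    have hdj : d ≤ j := Fin.le_def.2 (by omega)
    obtain ⟨h₁, e₁⟩ := hgt j.succ.succ d.castSucc β
      (by simp only [Fin.val_castSucc, Fin.val_succ]; omega) rfl
    obtain ⟨h₂, e₂⟩ := hgt i.succ.castSucc d.castSucc α
      (by simp only [Fin.val_castSucc, Fin.val_succ]; omega) rfl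
    rw [e₁, e₂, C.face_comp_gt i d α _ _ hdi _ (C.face_composable_gt i d α _ _ hdi h₁),
      C.face_comp_gt j d β _ _ hdj _ (C.face_composable_gt j d β _ _ hdj h₂)]
    exact key _ _ _ _ _ _ _ (A.2 _ _ _ _ hij) (B.2 _ _ _ _ hij)
  rcases Nat.lt_or_gt_of_ne hcj' with hltj | hgtj
  · -- `c` is between the two indices
    obtain ⟨d, rfl⟩ : ∃ d : Fin (n + 1), c = d.succ.castSucc :=
      ⟨⟨c - 1, by omega⟩, Fin.ext (by simp only [Fin.val_succ, Fin.val_castSucc]; omega)⟩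
    simp only [Fin.val_castSucc, Fin.val_succ] at *
    obtain ⟨i, rfl⟩ : ∃ k : Fin (n + 1), i = k.castSucc := ⟨⟨i, by omega⟩, rfl⟩
    obtain ⟨j, rfl⟩ : ∃ k : Fin (n + 1), j = k.succ :=
      ⟨⟨j - 1, by omega⟩, Fin.ext (by simp only [Fin.val_succ]; omega)⟩
    simp only [Fin.val_castSucc, Fin.val_succ] at *
    have hid : i ≤ d := Fin.le_def.2 (by omega)
    have hdj : d ≤ j := Fin.le_def.2 (by omega)
    obtain ⟨h₁, e₁⟩ := hgt j.succ.succ d.succ β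
      (by simp only [Fin.val_succ]; omega) rfl
    obtain ⟨h₂, e₂⟩ := hlt i.castSucc.castSucc d.castSucc α
      (by simp only [Fin.val_castSucc]; omega) rfl
    rw [e₁, e₂, C.face_comp_lt i d α _ _ hid _ (C.face_composable_lt i d α _ _ hid h₁),
      C.face_comp_gt j d β _ _ hdj _ (C.face_composable_gt j d β _ _ hdj h₂)]
    exact key _ _ _ _ _ _ _ (A.2 _ _ _ _ hij) (B.2 _ _ _ _ hij)
  · -- `c` is above both indices
    obtain ⟨d, rfl⟩ : ∃ d : Fin (n + 1), c = d.succ.succ :=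
      ⟨⟨c - 2, by omega⟩, Fin.ext (by simp only [Fin.val_succ]; omega)⟩
    simp only [Fin.val_succ] at *
    obtain ⟨i, rfl⟩ : ∃ k : Fin (n + 1), i = k.castSucc := ⟨⟨i, by omega⟩, rfl⟩
    obtain ⟨j, rfl⟩ : ∃ k : Fin (n + 1), j = k.castSucc := ⟨⟨j, by omega⟩, rfl⟩
    simp only [Fin.val_castSucc] at *
    have hid : i ≤ d := Fin.le_def.2 (by omega)
    have hjd : j ≤ d := Fin.le_def.2 (by omega)
    obtain ⟨h₁, e₁⟩ := hlt j.castSucc.succ d.succ β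
      (by simp only [Fin.val_castSucc, Fin.val_succ]; omega) rfl
    obtain ⟨h₂, e₂⟩ := hlt i.castSucc.castSucc d.succ α
      (by simp only [Fin.val_castSucc, Fin.val_succ]; omega) rfl
    rw [e₁, e₂, C.face_comp_lt i d α _ _ hid _ (C.face_composable_lt i d α _ _ hid h₁),
      C.face_comp_lt j d β _ _ hjd _ (C.face_composable_lt j d β _ _ hjd h₂)]
    exact key _ _ _ _ _ _ _ (A.2 _ _ _ _ hij) (B.2 _ _ _ _ hij)


/-- The composite `A ⋆_c B` of two shells. -/
def shellComp {n : ℕ} (c : Fin (n + 1)) (A B : C.Shell n) (h : A.1 c true = B.1 c false) :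
    C.Shell n :=
  ⟨C.shellCompFamily c A B h, C.isShell_shellCompFamily c A B h⟩

/-- The cells of dimensions `n` and `n + 1` of `□_n C`.  The shells `ε_i x` and `Γ_i^α x` of an
`n`-cell `x` have as components the faces of the cells `ε_i x` and `Γ_i^α x` of `C`, that is
`(ε_i x)_i^β = x`, `(ε_i x)_j^β = ε_{i_j} ∂_{j_i}^β x`, and similarly for `Γ_i^α`. -/
def boxLevel (n : ℕ) : CubicalLevel.{u} n where
  lower := C.cells n
  upper := C.Shell n
  face := fun i α A => A.1 i α
  deg := fun i x => C.shell (C.deg i x)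
  conn := fun i α x => C.shell (C.conn i α x)
  comp := C.shellComp

variable {C} {n : ℕ}

/-- `R_k`-invertibility of an `(n + 1)`-cell of `C`. -/
def RInvertible (k : Fin (n + 1)) (A : C.cells (n + 1)) : Prop :=
  (C.level n).RInvertible k A

/-- The shell of `A` is `R_k`-invertible in `□_n C`. -/
def HasRInvertibleShell (k : Fin (n + 1)) (A : C.cells (n + 1)) : Prop :=
  (C.boxLevel n).RInvertible k (C.shell A)

/-- `T_i`-invertibility of an `(n + 1)`-cell of `C`. -/
def TInvertible (i : Fin n) (A : C.cells (n + 1)) : Prop :=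
  (C.level n).TInvertible i A

/-- The shell of `A` is `T_i`-invertible in `□_n C`. -/
def HasTInvertibleShell (i : Fin n) (A : C.cells (n + 1)) : Prop :=
  (C.boxLevel n).TInvertible i (C.shell A)

/-- The folding operation `ψ_i A = Γ_i^+ ∂_{i+1}^- A ⋆_{i+1} A ⋆_{i+1} Γ_i^- ∂_{i+1}^+ A`. -/
def psi (i : Fin n) (A : C.cells (n + 1)) : C.cells (n + 1) :=
  C.comp i.succ
    (C.comp i.succ (C.conn i true (C.face i.succ false A)) A (C.face_conn_succ i true _))
    (C.conn i false (C.face i.succ true A))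
    ((C.face_comp_plus _ _ _ _).trans (C.face_conn_succ i false _).symm)

/-- `psiWord k` is `ψ_1 ψ_2 ⋯ ψ_k` (where `ψ_k` is applied first). -/
def psiWord : (k : ℕ) → k ≤ n → C.cells (n + 1) → C.cells (n + 1)
  | 0, _, A => A
  | k + 1, h, A => psiWord k (Nat.le_of_succ_le h) (psi ⟨k, h⟩ A)

/-- `bigPsi r` is `Ψ_{r+1} = ψ_r ⋯ ψ_1` (where `ψ_1` is applied first). -/
def bigPsi : (r : ℕ) → r ≤ n → C.cells (n + 1) → C.cells (n + 1)
  | 0, _, A => A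
  | r + 1, h, A => psi ⟨r, h⟩ (bigPsi r (Nat.le_of_succ_le h) A)

/-- `phi m` is `Φ_m = Ψ_1 ⋯ Ψ_m` (where `Ψ_m` is applied first). -/
def phi : (m : ℕ) → m ≤ n + 1 → C.cells (n + 1) → C.cells (n + 1)
  | 0, _, A => A
  | m + 1, h, A => phi m (Nat.le_of_succ_le h) (bigPsi m (Nat.le_of_succ_le_succ h) A)

/-- An `(n + 1)`-cell `A` is (plainly) invertible if `ψ_1 ⋯ ψ_n A` is `R_1`-invertible. -/
def Invertible (A : C.cells (n + 1)) : Prop :=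
  RInvertible 0 (psiWord n le_rfl A)

variable (C)

/-- The image of `ε_1` in the set of `n`-cells (empty for `n = 0`). -/
def imageDegOne : (n : ℕ) → Set (C.cells n)
  | 0 => ∅
  | _ + 1 => Set.range (C.deg 0)

end CubicalOmegaCat

-- Indices are those of the statement. The operation `ψ_i` only involves the directions `i` and `i +
-- 1`, so its behaviour is a matter of double categories with connections. There, a square is
-- determined by its boundary and its folding, and every square with the boundary of a folding can
-- be unfolded (`unfold_fold`, `fold_unfold`). Folding turns the left side of the T-equation into a
-- vertical composite of foldings, and turns a horizontal composite into a vertical composite of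
-- whiskered foldings (`v_fold_fold`, `fold_h`). Two equivalences follow. `A` is `T_i`-invertible
-- iff `ψ_i A` is `R_i`-invertible (`exists_tInverse_iff`). If the faces `∂_i^± A` are
-- `R_i`-invertible, then `A` is `R_{i+1}`-invertible iff `ψ_i A` is `R_i`-invertible
-- (`exists_hInverse_iff`).
--
-- For `k ≤ i`, `ψ_i` preserves `R_k`-invertibility, since connections on `R_k`-invertible faces are
-- `R_k`-invertible. Writing `A` as the unfolding of `ψ_i A` shows that `ψ_i` also reflects it when
-- the faces of `A` in directions beyond `k` are `R_k`-invertible. An invertible shell provides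
-- exactly these faces. The same arguments apply inside `□C`, so shells stay invertible along a
-- sequence of foldings; `Layer` axiomatises what is needed in order to treat cells and shells at
-- once.
--
-- Thus a cell with an `R_k`-invertible shell is `R_k`-invertible as soon as `ψ_1 ⋯ ψ_{n-1} A` is
-- `R_1`-invertible, which gives 1 → 2, and similarly with `Φ_n` when `k = 1`, which gives 5 → 3.
-- Conversely, foldings make faces degenerate: all faces of `ψ_1 ⋯ ψ_{n-1} A` and of `Φ_n A` in
-- directions other than 1 lie in `im ε_1`, whence 4 → 1 and 4 → 5. A cell with such faces has an
-- `R_1`-invertible shell (exchange its two faces in direction 1), whence 3 → 4, and it is fixed by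
-- `ψ_1`, so that `T_1`- and `R_1`-invertibility agree on it and 7 implies 1. Finally 1 → 6 follows
-- from 2 applied to `ψ_i A`.

universe v w

/-! ### Double categories with connections. -/

/-- An edge-symmetric double category with connections.  The two compositions of squares are the
horizontal one `h` and the vertical one `v`; all compositions are total functions, whose values are
only meaningful on composable arguments. -/
structure ConnDoubleCat (V : Type u) (E : Type v) (S : Type w) where
  src : E → V
  tgt : E → V
  one : V → E
  mul : E → E → E
  src_one : ∀ a, src (one a) = a
  tgt_one : ∀ a, tgt (one a) = a
  src_mul : ∀ f g, tgt f = src g → src (mul f g) = src f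
  tgt_mul : ∀ f g, tgt f = src g → tgt (mul f g) = tgt g
  one_mul : ∀ f a, src f = a → mul (one a) f = f
  mul_one : ∀ f a, tgt f = a → mul f (one a) = f
  mul_assoc : ∀ f g k, tgt f = src g → tgt g = src k → mul (mul f g) k = mul f (mul g k)
  top : S → E
  bot : S → E
  left : S → E
  right : S → E
  src_left : ∀ a, src (left a) = src (top a)
  src_right : ∀ a, src (right a) = tgt (top a)
  tgt_left : ∀ a, tgt (left a) = src (bot a)
  tgt_right : ∀ a, tgt (right a) = tgt (bot a)
  /-- the vertically degenerate square on an edge -/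
  vid : E → S
  /-- the horizontally degenerate square on an edge -/
  hid : E → S
  top_vid : ∀ f, top (vid f) = f
  bot_vid : ∀ f, bot (vid f) = f
  left_vid : ∀ f, left (vid f) = one (src f)
  right_vid : ∀ f, right (vid f) = one (tgt f)
  top_hid : ∀ f, top (hid f) = one (src f)
  bot_hid : ∀ f, bot (hid f) = one (tgt f)
  left_hid : ∀ f, left (hid f) = f
  right_hid : ∀ f, right (hid f) = f
  hid_one : ∀ a, hid (one a) = vid (one a)
  v : S → S → S
  h : S → S → S
  top_v : ∀ a b, bot a = top b → top (v a b) = top a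
  bot_v : ∀ a b, bot a = top b → bot (v a b) = bot b
  left_v : ∀ a b, bot a = top b → left (v a b) = mul (left a) (left b)
  right_v : ∀ a b, bot a = top b → right (v a b) = mul (right a) (right b)
  top_h : ∀ a b, right a = left b → top (h a b) = mul (top a) (top b)
  bot_h : ∀ a b, right a = left b → bot (h a b) = mul (bot a) (bot b)
  left_h : ∀ a b, right a = left b → left (h a b) = left a
  right_h : ∀ a b, right a = left b → right (h a b) = right b
  vid_v : ∀ a f, top a = f → v (vid f) a = a
  v_vid : ∀ a f, bot a = f → v a (vid f) = a
  hid_h : ∀ a f, left a = f → h (hid f) a = a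
  h_hid : ∀ a f, right a = f → h a (hid f) = a
  v_assoc : ∀ a b c, bot a = top b → bot b = top c → v (v a b) c = v a (v b c)
  h_assoc : ∀ a b c, right a = left b → right b = left c → h (h a b) c = h a (h b c)
  interchange : ∀ a b c d, right a = left b → right c = left d → bot a = top c → bot b = top d →
    v (h a b) (h c d) = h (v a c) (v b d)
  vid_mul : ∀ f g, tgt f = src g → vid (mul f g) = h (vid f) (vid g)
  hid_mul : ∀ f g, tgt f = src g → hid (mul f g) = v (hid f) (hid g)
  /-- the connection with target edges `bot` and `right` equal to the given edge -/
  cp : E → S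
  /-- the connection with source edges `top` and `left` equal to the given edge -/
  cm : E → S
  top_cp : ∀ f, top (cp f) = one (src f)
  left_cp : ∀ f, left (cp f) = one (src f)
  bot_cp : ∀ f, bot (cp f) = f
  right_cp : ∀ f, right (cp f) = f
  top_cm : ∀ f, top (cm f) = f
  left_cm : ∀ f, left (cm f) = f
  bot_cm : ∀ f, bot (cm f) = one (tgt f)
  right_cm : ∀ f, right (cm f) = one (tgt f)
  v_cp_cm : ∀ f, v (cp f) (cm f) = hid f
  h_cp_cm : ∀ f, h (cp f) (cm f) = vid f

namespace ConnDoubleCat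

variable {V : Type u} {E : Type v} {S : Type w} (D : ConnDoubleCat V E S)

attribute [simp] src_one tgt_one src_mul tgt_mul one_mul mul_one src_left src_right
  tgt_left tgt_right top_vid bot_vid left_vid right_vid top_hid bot_hid left_hid right_hid
  top_v bot_v left_v right_v top_h bot_h left_h right_h vid_v v_vid hid_h h_hid
  top_cp left_cp bot_cp right_cp top_cm left_cm bot_cm right_cm v_cp_cm h_cp_cm hid_one

/-- `g` is inverse to the edge `f`. -/
def EdgeInverse (f g : E) : Prop :=
  D.tgt f = D.src g ∧ D.tgt g = D.src f ∧ D.mul f g = D.one (D.src f) ∧ D.mul g f = D.one (D.tgt f)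

/-- `b` is a vertical inverse of the square `a`. -/
def VInverse (a b : S) : Prop :=
  D.bot a = D.top b ∧ D.bot b = D.top a ∧ D.v a b = D.vid (D.top a) ∧ D.v b a = D.vid (D.bot a)

/-- `b` is a horizontal inverse of the square `a`. -/
def HInverse (a b : S) : Prop :=
  D.right a = D.left b ∧ D.right b = D.left a ∧
    D.h a b = D.hid (D.left a) ∧ D.h b a = D.hid (D.right a)

/-! ### Inverses of connections. -/

variable {D}

theorem EdgeInverse.symm {f g : E} (H : D.EdgeInverse f g) : D.EdgeInverse g f := by
  obtain ⟨h₁, h₂, h₃, h₄⟩ := H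
  exact ⟨h₂, h₁, h₁ ▸ h₄, h₂ ▸ h₃⟩

/-- The square `Γ⁻ x / ε x⁻¹ / Γ⁺ x` is degenerate. -/
theorem v_cm_hid_cp {x y : E} (H : D.EdgeInverse x y) :
    D.v (D.v (D.cm x) (D.hid y)) (D.cp x) = D.vid x := by
  obtain ⟨h₁, h₂, h₃, h₄⟩ := H
  set Q := D.v (D.v (D.cm x) (D.hid y)) (D.cp x) with hQ
  have ht : D.top Q = x := by simp [hQ, h₁, h₂]
  have hl : D.left Q = D.one (D.src x) := by simp [hQ, h₁, h₂, h₃]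
  have hr : D.right Q = D.one (D.tgt x) := by
    rw [hQ, D.right_v _ _ (by simp [h₁, h₂]), D.right_v _ _ (by simp [h₁])]
    simp [h₁, h₄]
  -- Below `cp x`, the first factor of `Q` gives `hid x`, which cancels `hid y`. Since `cp x` and
  -- `cm x` compose horizontally to an identity, this absorption forces `Q` to be degenerate.
  have hcp : D.v (D.cp x) Q = D.cp x := by
    rw [hQ, D.v_assoc _ _ _ (by simp [h₁]) (by simp [h₂]),
      ← D.v_assoc _ _ _ (by simp) (by simp [h₁, h₂]), D.v_cp_cm,
      ← D.v_assoc _ _ _ (by simp [h₁]) (by simp [h₂]), ← D.hid_mul _ _ h₁, h₃]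
    simp
  calc Q = D.v (D.h (D.cp x) (D.cm x)) (D.h Q (D.hid (D.one (D.tgt x)))) := by
        rw [D.h_cp_cm, D.h_hid _ _ hr, D.vid_v _ _ ht]
    _ = D.vid x := by
        rw [D.interchange _ _ _ _ (by simp) (by simp [hr]) (by simp [ht]) (by simp), hcp]
        simp

theorem VInverse.cp {x y : E} (H : D.EdgeInverse x y) :
    D.VInverse (D.cp x) (D.v (D.cm x) (D.hid y)) := by
  have h₅ := v_cm_hid_cp H
  obtain ⟨h₁, h₂, h₃, h₄⟩ := H
  refine ⟨by simp [h₁], by simp [h₁, h₂], ?_, by simpa using h₅⟩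
  rw [← D.v_assoc _ _ _ (by simp) (by simp [h₁]), D.v_cp_cm, ← D.hid_mul _ _ h₁, h₃]
  simp

theorem VInverse.cm {x y : E} (H : D.EdgeInverse x y) :
    D.VInverse (D.cm x) (D.v (D.hid y) (D.cp x)) := by
  have h₅ := v_cm_hid_cp H
  obtain ⟨h₁, h₂, h₃, h₄⟩ := H
  refine ⟨by simp [h₁, h₂], by simp [h₂], ?_, ?_⟩
  · rw [← D.v_assoc _ _ _ (by simp [h₁]) (by simp [h₂]), h₅]; simp
  · rw [D.v_assoc _ _ _ (by simp [h₂]) (by simp), D.v_cp_cm, ← D.hid_mul _ _ h₂, h₄]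
    simp

/-! ### Folding and unfolding of squares. -/

variable (D)

/-- The folding of a square. -/
def fold (a : S) : S := D.h (D.h (D.cp (D.left a)) a) (D.cm (D.right a))

/-- The square with top `p`, right `y`, left `x` and bottom `q` that folds to `z`. -/
def unfold (p y x q : E) (z : S) : S :=
  D.v (D.v (D.h (D.vid p) (D.cp y)) z) (D.h (D.cm x) (D.vid q))

theorem top_fold (a : S) : D.top (D.fold a) = D.mul (D.top a) (D.right a) := by
  simp [fold]

theorem bot_fold (a : S) : D.bot (D.fold a) = D.mul (D.left a) (D.bot a) := by
  simp [fold]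

theorem left_fold (a : S) : D.left (D.fold a) = D.one (D.src (D.top a)) := by
  simp [fold]

theorem right_fold (a : S) : D.right (D.fold a) = D.one (D.tgt (D.bot a)) := by
  simp [fold]

attribute [simp] top_fold bot_fold left_fold right_fold

theorem interchange₃ (a₁ a₂ a₃ b₁ b₂ b₃ c₁ c₂ c₃ : S)
    (ha : D.right a₁ = D.left a₂) (ha' : D.right a₂ = D.left a₃)
    (hb : D.right b₁ = D.left b₂) (hb' : D.right b₂ = D.left b₃)
    (hc : D.right c₁ = D.left c₂) (hc' : D.right c₂ = D.left c₃)
    (h₁ : D.bot a₁ = D.top b₁) (h₁' : D.bot b₁ = D.top c₁)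
    (h₂ : D.bot a₂ = D.top b₂) (h₂' : D.bot b₂ = D.top c₂)
    (h₃ : D.bot a₃ = D.top b₃) (h₃' : D.bot b₃ = D.top c₃) :
    D.v (D.v (D.h (D.h a₁ a₂) a₃) (D.h (D.h b₁ b₂) b₃)) (D.h (D.h c₁ c₂) c₃) =
      D.h (D.h (D.v (D.v a₁ b₁) c₁) (D.v (D.v a₂ b₂) c₂)) (D.v (D.v a₃ b₃) c₃) := by
  rw [D.interchange _ _ _ _ (by simp [*]) (by simp [*]) (by simp [*]) h₃,
    D.interchange _ _ _ _ ha hb h₁ h₂,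
    D.interchange _ _ _ _ (by simp [*]) (by simp [*]) (by simp [*]) (by simp [*]),
    D.interchange _ _ _ _ (by simp [*]) hc (by simp [*]) (by simp [*])]

/-- Pad the three rows with identities to a 3 × 3 array: `1, vid, cp` over `cp, a, cm` over `cm,
vid, 1`. Composing columns first, the outer ones become `hid` of the left and right edges and the
middle one is `a`. -/
theorem unfold_fold (a : S) :
    D.unfold (D.top a) (D.right a) (D.left a) (D.bot a) (D.fold a) = a := by
  have h₁ : D.h (D.vid (D.top a)) (D.cp (D.right a)) =
      D.h (D.h (D.vid (D.one (D.src (D.top a)))) (D.vid (D.top a))) (D.cp (D.right a)) := by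
    rw [← D.hid_one, D.hid_h _ _ (by simp)]
  have h₂ : D.h (D.cm (D.left a)) (D.vid (D.bot a)) =
      D.h (D.h (D.cm (D.left a)) (D.vid (D.bot a))) (D.vid (D.one (D.tgt (D.bot a)))) := by
    rw [← D.hid_one, D.h_hid _ _ (by simp)]
  rw [unfold, fold, h₁, h₂, interchange₃]
  all_goals simp

theorem ext_of_fold {a b : S} (ht : D.top a = D.top b) (hb : D.bot a = D.bot b)
    (hl : D.left a = D.left b) (hr : D.right a = D.right b) (hf : D.fold a = D.fold b) : a = b := by
  rw [← D.unfold_fold a, ← D.unfold_fold b, ht, hb, hl, hr, hf]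

/-- The square `z` has the boundary of the folding of a square with top `p`, right `y`, left `x` and
bottom `q`. -/
structure IsFolded (p y x q : E) (z : S) : Prop where
  tgt_p : D.tgt p = D.src y
  tgt_x : D.tgt x = D.src q
  top : D.top z = D.mul p y
  bot : D.bot z = D.mul x q
  left : D.left z = D.one (D.src p)
  right : D.right z = D.one (D.tgt q)

variable {D}

namespace IsFolded

variable {p y x q : E} {z : S}

theorem src_eq (H : D.IsFolded p y x q z) : D.src x = D.src p := by
  have h := D.tgt_left z
  rw [H.left, H.bot] at h
  simpa [H.tgt_x] using h.symm

theorem tgt_eq (H : D.IsFolded p y x q z) : D.tgt y = D.tgt q := by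
  have h := D.src_right z
  rw [H.right, H.top] at h
  simpa [H.tgt_p] using h.symm

theorem top_unfold (H : D.IsFolded p y x q z) : D.top (D.unfold p y x q z) = p := by
  simp (maxDischargeDepth := 5) [unfold, H.tgt_p, H.tgt_x, H.top, H.bot]

theorem bot_unfold (H : D.IsFolded p y x q z) : D.bot (D.unfold p y x q z) = q := by
  simp (maxDischargeDepth := 5) [unfold, H.tgt_p, H.tgt_x, H.top, H.bot]

theorem left_unfold (H : D.IsFolded p y x q z) : D.left (D.unfold p y x q z) = x := by
  simp (maxDischargeDepth := 5)
    [unfold, H.tgt_p, H.tgt_x, H.top, H.bot, H.left, H.src_eq]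

theorem right_unfold (H : D.IsFolded p y x q z) : D.right (D.unfold p y x q z) = y := by
  simp (maxDischargeDepth := 5)
    [unfold, H.tgt_p, H.tgt_x, H.top, H.bot, H.right, H.tgt_eq]

/-- The same 3 × 3 trick in the other direction: padding `cp x` from above and `cm y` from below
makes the outer rows equal to `vid` of `mul p y` and of `mul x q`, leaving `z`. -/
theorem fold_unfold (H : D.IsFolded p y x q z) : D.fold (D.unfold p y x q z) = z := by
  have e₁ : D.cp x = D.v (D.v (D.vid (D.one (D.src x))) (D.vid (D.one (D.src x)))) (D.cp x) := by
    simp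
  have e₂ : D.cm y = D.v (D.v (D.cm y) (D.vid (D.one (D.tgt y)))) (D.vid (D.one (D.tgt y))) := by
    simp
  rw [fold, H.left_unfold, H.right_unfold, e₁, e₂, unfold, ← interchange₃]
  · clear e₁ e₂
    rw [← D.hid_one, ← D.hid_one, D.hid_h (D.h (D.vid p) _), D.hid_h z, D.h_hid z, D.h_hid,
      D.h_assoc (D.vid _) _ (D.cm y), D.h_cp_cm, ← D.vid_mul _ _ H.tgt_p,
      ← D.h_assoc (D.cp x), D.h_cp_cm, ← D.vid_mul _ _ H.tgt_x]
    all_goals simp (maxDischargeDepth := 5)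
      [H.tgt_p, H.tgt_x, H.top, H.bot, H.left, H.right, H.src_eq, H.tgt_eq]
  all_goals
    clear e₁ e₂
    simp (maxDischargeDepth := 5)
      [H.tgt_p, H.tgt_x, H.top, H.bot, H.left, H.right, H.src_eq, H.tgt_eq]

end IsFolded

theorem fold_hid (f : E) : D.fold (D.hid f) = D.vid f := by
  simp [fold]

/-- In the two-row array on the right, `cp` of the common edge of `a` and `b` lies above `cm` of
that edge. This column is an identity, and the remaining ones spell the folding of `h a b`. The
order is reversed: `b` is in the upper row. -/
theorem fold_h (a b : S) (H : D.right a = D.left b) :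
    D.fold (D.h a b) =
      D.v (D.h (D.vid (D.top a)) (D.fold b)) (D.h (D.fold a) (D.vid (D.bot b))) := by
  have h₁ : D.tgt (D.top a) = D.src (D.top b) := by rw [← D.src_right, H, D.src_left]
  have h₂ : D.tgt (D.bot a) = D.src (D.bot b) := by rw [← D.tgt_right, H, D.tgt_left]
  have e₁ : D.h (D.vid (D.top a)) (D.fold b) =
      D.h (D.h (D.h (D.vid (D.one (D.src (D.top a)))) (D.vid (D.top a)))
        (D.cp (D.left b))) (D.h b (D.cm (D.right b))) := by
    rw [← D.hid_one, D.hid_h _ _ (by simp), fold]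
    rw [D.h_assoc (D.cp _) _ _ (by simp) (by simp), ← D.h_assoc]
    all_goals simp (maxDischargeDepth := 5) [h₁, ← H]
  have e₂ : D.h (D.fold a) (D.vid (D.bot b)) =
      D.h (D.h (D.h (D.cp (D.left a)) a) (D.cm (D.right a)))
        (D.h (D.vid (D.bot b)) (D.vid (D.one (D.tgt (D.bot b))))) := by
    rw [← D.hid_one, D.h_hid _ _ (by simp), fold]
  rw [e₁, e₂, D.interchange, D.interchange, D.interchange, D.interchange]
  · rw [H]
    rw [D.v_cp_cm, D.vid_v _ _ (by simp), D.vid_v _ _ rfl, D.v_vid _ _ rfl, D.v_vid _ _ (by simp),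
      D.h_hid _ _ (by simp [H]), ← D.h_assoc, fold, D.left_h _ _ H, D.right_h _ _ H, ← D.h_assoc (D.cp _) a b]
    all_goals simp [H]
  all_goals simp (maxDischargeDepth := 6) [h₁, H]

/-! ### Transposed inverses and foldings. -/

/-- The equation expressing that `b` is a transposed inverse of `a` on one side. -/
def TEq (a b : S) : Prop :=
  D.h (D.v (D.cp (D.left a)) b) (D.v a (D.cm (D.bot a))) =
    D.v (D.cm (D.top a)) (D.cp (D.right a))

/-- The boundary of `b` is the transpose of that of `a`. -/
structure Transposed (a b : S) : Prop where
  top : D.top a = D.left b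
  bot : D.bot a = D.right b
  left : D.left a = D.top b
  right : D.right a = D.bot b

/-- `b` is a `T`-inverse of `a`. -/
def TInverse (a b : S) : Prop := D.Transposed a b ∧ D.TEq a b ∧ D.TEq b a

theorem Transposed.symm {a b : S} (H : D.Transposed a b) : D.Transposed b a :=
  ⟨H.left.symm, H.right.symm, H.top.symm, H.bot.symm⟩

/-- Shift the row of `fold a` one column to the right of that of `fold b`, padding with identities.
The columns are then `cp (left b)`, the two vertical composites of the T-equation, and `cm (right
a)`. -/
theorem v_fold_fold {a b : S} (H : D.Transposed a b) : D.v (D.fold a) (D.fold b) =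
    D.fold (D.h (D.v (D.cp (D.left a)) b) (D.v a (D.cm (D.bot a)))) := by
  obtain ⟨ht, hb, hl, hr⟩ := H
  have e₁ : D.fold a = D.h (D.h (D.vid (D.one (D.src (D.top a)))) (D.cp (D.left a)))
      (D.h a (D.cm (D.right a))) := by
    rw [← D.hid_one, D.hid_h _ _ (by simp), fold, D.h_assoc] <;> simp
  have e₂ : D.fold b = D.h (D.h (D.cp (D.left b)) b)
      (D.h (D.cm (D.right b)) (D.vid (D.one (D.tgt (D.bot b))))) := by
    rw [← D.hid_one, D.h_hid _ _ (by simp), fold]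
  have e₃ : D.left (D.h (D.v (D.cp (D.left a)) b) (D.v a (D.cm (D.bot a)))) = D.left b := by
    have := D.src_left b
    simp (maxDischargeDepth := 6) [hb, hl]
  have e₄ : D.right (D.h (D.v (D.cp (D.left a)) b) (D.v a (D.cm (D.bot a)))) = D.right a := by
    have := D.tgt_right a
    simp (maxDischargeDepth := 6) [hb, hl]
  rw [e₁, e₂, D.interchange, D.interchange, D.interchange, fold, e₃, e₄,
    D.vid_v _ _ (by simp [← ht]), D.v_vid _ _ (by simp [hr]), hb, ← D.h_assoc, ← D.h_assoc]
  all_goals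
    clear e₁ e₂ e₃ e₄
    have h₁ := D.src_left b
    have h₂ := D.tgt_right a
    simp (maxDischargeDepth := 6) [← ht, hb, ← hl, hr] at *
    try simp [*]

/-- This computes the folding of the right side of the T-equation: each of the two rows contains a
`cp`, `cm` pair, which cancels. -/
theorem fold_v_cm_cp {p y : E} (H : D.tgt p = D.src y) :
    D.fold (D.v (D.cm p) (D.cp y)) = D.vid (D.mul p y) := by
  have e₁ : D.cp p = D.v (D.cp p) (D.vid p) := by simp
  have e₂ : D.cm y = D.v (D.vid y) (D.cm y) := by simp
  rw [fold, D.left_v _ _ (by simp [H]), D.right_v _ _ (by simp [H]), D.left_cm, D.right_cm,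
    D.left_cp, D.right_cp, D.mul_one _ _ H, D.one_mul _ _ H.symm, e₁, e₂, ← D.interchange,
    ← D.interchange]
  · clear e₁ e₂
    rw [D.h_assoc (D.vid p), D.h_cp_cm, D.h_cp_cm, ← D.vid_mul _ _ H] <;> simp [H]
  all_goals
    clear e₁ e₂
    simp [H]

/-- Both sides of the T-equation have the same boundary, so they may be compared after folding. -/
theorem tEq_iff {a b : S} (H : D.Transposed a b) :
    D.TEq a b ↔ D.v (D.fold a) (D.fold b) = D.vid (D.top (D.fold a)) := by
  rw [v_fold_fold H, top_fold, ← fold_v_cm_cp (D.src_right a).symm]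
  refine ⟨fun h => congrArg _ h, fun h => D.ext_of_fold ?_ ?_ ?_ ?_ h⟩
  all_goals simp (maxDischargeDepth := 6) [H.top, H.bot, H.left, H.right]

theorem TInverse.fold {a b : S} (H : D.TInverse a b) : D.VInverse (D.fold a) (D.fold b) := by
  obtain ⟨H, h₁, h₂⟩ := H
  have h₃ : D.bot (D.fold a) = D.top (D.fold b) := by simp [H.left, H.bot]
  exact ⟨h₃, by simp [H.top, H.right], (tEq_iff H).1 h₁,
    by rw [(tEq_iff H.symm).1 h₂, h₃]⟩

/-- Together with `VInverse.right`, this says that an inverse of a folding again has degenerate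
lateral edges, and hence can be unfolded. -/
theorem VInverse.left {a b : S} {x : V} (H : D.VInverse a b) (h : D.left a = D.one x)
    (hx : x = D.src (D.top a)) : D.left b = D.one x := by
  obtain ⟨h₁, h₂, h₃, h₄⟩ := H
  have e := congrArg D.left h₃
  have hs := D.tgt_left a
  rw [h, D.tgt_one, h₁] at hs
  rwa [D.left_v _ _ h₁, h, D.one_mul _ _ (by simp [hs]), D.left_vid, ← hx] at e

theorem VInverse.right {a b : S} {x : V} (H : D.VInverse a b) (h : D.right a = D.one x)
    (hx : x = D.tgt (D.top a)) : D.right b = D.one x := by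
  obtain ⟨h₁, h₂, h₃, h₄⟩ := H
  have e := congrArg D.right h₃
  have hs := D.tgt_right a
  rw [h, D.tgt_one, h₁] at hs
  rwa [D.right_v _ _ h₁, h, D.one_mul _ _ (by simp [hs]), D.right_vid, ← hx] at e

theorem exists_tInverse_iff (a : S) :
    (∃ b, D.TInverse a b) ↔ ∃ b, D.VInverse (D.fold a) b := by
  refine ⟨fun ⟨b, hb⟩ => ⟨_, hb.fold⟩, fun ⟨z, hz⟩ => ?_⟩
  have hl := hz.left (D.left_fold a) (by simp)
  have hr := hz.right (D.right_fold a) (by simp)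
  obtain ⟨h₁, h₂, h₃, h₄⟩ := hz
  -- The T-inverse is the unfolding of `z` along the transposed boundary of `a`.
  have H : D.IsFolded (D.left a) (D.bot a) (D.top a) (D.right a) z :=
    ⟨by simp, by simp, by simp [← h₁], by simp [h₂], by simp [hl], by simp [hr]⟩
  have T : D.Transposed a (D.unfold (D.left a) (D.bot a) (D.top a) (D.right a) z) :=
    ⟨H.left_unfold.symm, H.right_unfold.symm, H.top_unfold.symm, H.bot_unfold.symm⟩
  refine ⟨_, T, (tEq_iff T).2 ?_, (tEq_iff T.symm).2 ?_⟩
  · rw [H.fold_unfold, h₃]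
  · rw [H.fold_unfold, h₄, h₁]

/-! ### Horizontal inverses and foldings. -/

theorem HInverse.top {a b : S} (H : D.HInverse a b) : D.EdgeInverse (D.top a) (D.top b) := by
  obtain ⟨h₁, h₂, h₃, h₄⟩ := H
  refine ⟨by rw [← D.src_right, h₁, D.src_left], by rw [← D.src_right, h₂, D.src_left], ?_, ?_⟩
  · rw [← D.top_h _ _ h₁, h₃, D.top_hid, D.src_left]
  · rw [← D.top_h _ _ h₂, h₄, D.top_hid, D.src_right]

theorem HInverse.bot {a b : S} (H : D.HInverse a b) : D.EdgeInverse (D.bot a) (D.bot b) := by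
  obtain ⟨h₁, h₂, h₃, h₄⟩ := H
  refine ⟨by rw [← D.tgt_right, h₁, D.tgt_left], by rw [← D.tgt_right, h₂, D.tgt_left], ?_, ?_⟩
  · rw [← D.bot_h _ _ h₁, h₃, D.bot_hid, D.tgt_left]
  · rw [← D.bot_h _ _ h₂, h₄, D.bot_hid, D.tgt_right]

theorem h_v_vid {a b : S} {f : E} (H : D.bot a = D.top b) (ha : D.right a = D.one (D.src f))
    (hb : D.right b = D.one (D.src f)) :
    D.v (D.h a (D.vid f)) (D.h b (D.vid f)) = D.h (D.v a b) (D.vid f) := by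
  rw [D.interchange _ _ _ _ (by simp [ha]) (by simp [hb]) H (by simp), D.v_vid _ _ (by simp)]

theorem vid_h_v {a b : S} {f : E} (H : D.bot a = D.top b) (ha : D.left a = D.one (D.tgt f))
    (hb : D.left b = D.one (D.tgt f)) :
    D.v (D.h (D.vid f) a) (D.h (D.vid f) b) = D.h (D.vid f) (D.v a b) := by
  rw [D.interchange _ _ _ _ (by simp [ha]) (by simp [hb]) (by simp) H, D.v_vid _ _ (by simp)]

theorem mul_mul_of_inverse {f g k : E} (H : D.EdgeInverse f g) (hk : D.src k = D.src f) :
    D.mul f (D.mul g k) = k := by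
  obtain ⟨h₁, h₂, h₃, h₄⟩ := H
  rw [← D.mul_assoc _ _ _ h₁ (by rw [h₂, hk]), h₃, D.one_mul _ _ hk]

theorem mul_mul_of_inverse' {f g k : E} (H : D.EdgeInverse f g) (hk : D.tgt k = D.src f) :
    D.mul (D.mul k f) g = k := by
  obtain ⟨h₁, h₂, h₃, h₄⟩ := H
  rw [D.mul_assoc _ _ _ hk h₁, h₃, D.mul_one _ _ hk]

theorem vid_h_vid_h {f g : E} {a : S} (H : D.EdgeInverse f g) (ha : D.left a = D.one (D.src f)) :
    D.h (D.vid f) (D.h (D.vid g) a) = a := by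
  obtain ⟨h₁, h₂, h₃, h₄⟩ := H
  rw [← D.h_assoc _ _ _ (by simp [h₁]) (by simp [ha, h₂]), ← D.vid_mul _ _ h₁, h₃, ← D.hid_one,
    D.hid_h _ _ ha]

theorem h_vid_h_vid {f g : E} {a : S} (H : D.EdgeInverse f g) (ha : D.right a = D.one (D.src f)) :
    D.h (D.h a (D.vid f)) (D.vid g) = a := by
  obtain ⟨h₁, h₂, h₃, h₄⟩ := H
  rw [D.h_assoc _ _ _ (by simp [ha]) (by simp [h₁]), ← D.vid_mul _ _ h₁, h₃, ← D.hid_one,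
    D.h_hid _ _ ha]

/-- `fold_h`, applied to `h a b` and `h b a`, shows that `fold b` inverts `fold a` up to whiskering
by the top and bottom edges. These edges are invertible, so the whiskering can be moved to one side.
-/
theorem HInverse.fold {a b : S} (H : D.HInverse a b) :
    D.VInverse (D.fold a) (D.h (D.h (D.vid (D.top a)) (D.fold b)) (D.vid (D.bot a))) := by
  have hp := H.top
  have hq := H.bot
  obtain ⟨h₁, h₂, h₃, h₄⟩ := H
  have e₁ := D.fold_h a b h₁
  have e₂ := D.fold_h b a h₂
  rw [h₃, fold_hid] at e₁
  rw [h₄, fold_hid] at e₂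
  have s₁ : D.tgt (D.bot b) = D.src (D.bot a) := hq.2.1
  have s₂ : D.tgt (D.top a) = D.src (D.top b) := hp.1
  have s₃ : D.mul (D.top b) (D.left a) = D.top (D.fold b) := by rw [top_fold, h₂]
  have s₄ : D.mul (D.right a) (D.bot b) = D.bot (D.fold b) := by rw [bot_fold, h₁]
  have l₁ : D.right (D.vid (D.top a)) = D.left (D.fold b) := by simp [s₂]
  have l₂ : D.right (D.fold b) = D.left (D.vid (D.bot a)) := by simp [s₁]
  have e₃ : D.left (D.fold a) = D.one (D.src (D.top a)) := D.left_fold a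
  have e₄ : D.right (D.fold a) = D.one (D.src (D.bot b)) := by simp [hq.1]
  have t₁ : D.top (D.h (D.vid (D.top a)) (D.fold b)) = D.left a := by
    rw [D.top_h _ _ l₁, D.top_vid, ← s₃, mul_mul_of_inverse hp (by simp)]
  have t₂ : D.bot (D.h (D.fold b) (D.vid (D.bot a))) = D.right a := by
    rw [D.bot_h _ _ l₂, D.bot_vid, ← s₄, mul_mul_of_inverse' hq.symm (by simp [hq.1])]
  refine ⟨?_, ?_, ?_, ?_⟩
  · rw [D.top_h _ _ (by rw [D.right_h _ _ l₁, l₂]), t₁]; simp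
  · rw [D.h_assoc _ _ _ l₁ l₂, D.bot_h _ _ (by rw [D.left_h _ _ l₂, l₁]), t₂]; simp
  -- Inserting `top a` and its inverse `top b` in front of `fold a` exposes a common whiskering by
  -- `top a`; what remains is the composite evaluated by `e₂`.
  · nth_rw 1 [D.h_assoc _ _ _ l₁ l₂, ← vid_h_vid_h hp e₃]
    rw [vid_h_v, ← e₂, ← D.vid_mul _ _ (D.src_right a).symm, top_fold]
    · rw [D.bot_h _ _ (by simp [hp.2.1]), D.top_h _ _ l₂, ← s₃, bot_fold, D.bot_vid, D.top_vid,
        D.mul_assoc _ _ _ (by simp [hp.2.1]) (by simp)]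
    · rw [D.left_h _ _ (by simp [hp.2.1]), D.left_vid, s₂]
    · rw [D.left_h _ _ l₂, l₁.symm, D.right_vid]
  · nth_rw 1 [← h_vid_h_vid hq.symm e₄]
    rw [h_v_vid, ← e₁, ← D.vid_mul _ _ (D.tgt_left a), bot_fold]
    · rw [D.bot_h _ _ l₁, D.top_h _ _ (by simp [hq.1]), ← s₄, top_fold, D.bot_vid, D.top_vid,
        D.mul_assoc _ _ _ (by simp) (by simp [hq.1])]
    · rw [D.right_h _ _ l₁, l₂, D.left_vid]
    · rw [D.right_h _ _ (by simp [hq.1]), D.right_vid, s₁]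

theorem exists_hInverse_iff {a : S} {p q : E} (hp : D.EdgeInverse (D.top a) p)
    (hq : D.EdgeInverse (D.bot a) q) :
    (∃ b, D.HInverse a b) ↔ ∃ b, D.VInverse (D.fold a) b := by
  refine ⟨fun ⟨b, hb⟩ => ⟨_, hb.fold⟩, fun ⟨z, hz⟩ => ?_⟩
  have hl := hz.left (D.left_fold a) (by simp)
  have hr := hz.right (D.right_fold a) (by simp)
  obtain ⟨h₁, h₂, h₃, h₄⟩ := hz
  have p₁ : D.tgt p = D.src (D.top a) := hp.2.1
  have p₂ : D.tgt (D.top a) = D.src p := hp.1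
  have q₁ : D.tgt (D.bot a) = D.src q := hq.1
  have q₂ : D.tgt q = D.src (D.bot a) := hq.2.1
  have l₁ : D.right (D.vid p) = D.left z := by simp [hl, p₁]
  have l₂ : D.right z = D.left (D.vid q) := by simp [hr, q₁]
  have t₁ : D.top (D.h z (D.vid q)) = D.left a := by
    rw [D.top_h _ _ l₂, D.top_vid, ← h₁, bot_fold, mul_mul_of_inverse' hq (by simp)]
  have t₂ : D.bot (D.h (D.vid p) z) = D.right a := by
    rw [D.bot_h _ _ l₁, D.bot_vid, h₂, top_fold, mul_mul_of_inverse hp.symm (by simp [p₂])]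
  -- `HInverse.fold` solved for `fold b`: whiskering by the inverse edges `p` and `q` gives the
  -- folding that the horizontal inverse must have.
  set w := D.h (D.h (D.vid p) z) (D.vid q) with hw
  have hw' : w = D.h (D.vid p) (D.h z (D.vid q)) := D.h_assoc _ _ _ l₁ l₂
  have H : D.IsFolded p (D.left a) (D.right a) q w := by
    refine ⟨by simp [p₁], by simp [q₁], ?_, ?_, ?_, ?_⟩
    · rw [hw', D.top_h _ _ (by rw [D.left_h _ _ l₂, l₁]), t₁, D.top_vid]
    · rw [hw, D.bot_h _ _ (by rw [D.right_h _ _ l₁, l₂]), t₂, D.bot_vid]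
    · rw [hw', D.left_h _ _ (by rw [D.left_h _ _ l₂, l₁]), D.left_vid]
    · rw [hw, D.right_h _ _ (by rw [D.right_h _ _ l₁, l₂]), D.right_vid]
  set b := D.unfold p (D.left a) (D.right a) q w
  have b₁ : D.right a = D.left b := H.left_unfold.symm
  have b₂ : D.right b = D.left a := H.right_unfold
  have b₃ : D.top b = p := H.top_unfold
  have b₄ : D.bot b = q := H.bot_unfold
  refine ⟨b, b₁, b₂, D.ext_of_fold ?_ ?_ ?_ ?_ ?_, D.ext_of_fold ?_ ?_ ?_ ?_ ?_⟩
  · simp [b₁, b₃, hp.2.2.1]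
  · simp [b₁, b₄, hq.2.2.1]
  · simp [b₁]
  · simp [b₁, b₂]
  -- The edge `top a` cancels `p`, and the remaining whiskering by `q` is common to `z` and `fold
  -- a`, whose composite is an identity.
  · rw [D.fold_h _ _ b₁, H.fold_unfold, fold_hid, b₄, hw', vid_h_vid_h hp, h_v_vid, h₄, ← D.vid_mul,
      bot_fold, mul_mul_of_inverse' hq]
    all_goals simp [hl, hr, q₁, h₂]
  · simp [b₂, b₃, hp.2.2.2]
  · simp [b₂, b₄, hq.2.2.2]
  · simp [b₂, b₁]
  · simp [b₂]
  · rw [D.fold_h _ _ b₂, H.fold_unfold, fold_hid, b₃, hw, h_vid_h_vid hq.symm, vid_h_v, h₃,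
      ← D.vid_mul, top_fold, mul_mul_of_inverse hp.symm]
    all_goals simp [*]

end ConnDoubleCat

/-! ### Totalised compositions in a cubical `ω`-category. -/

open Classical in
/-- Composition as a total function; its value is `a` if `a` and `b` are not composable. -/
noncomputable def CubicalLevel.cmp {n : ℕ} (L : CubicalLevel.{u} n) (i : Fin (n + 1))
    (a b : L.upper) : L.upper :=
  if h : L.face i true a = L.face i false b then L.comp i a b h else a

theorem CubicalLevel.rInvertible_iff {n : ℕ} (L : CubicalLevel.{u} n) (k : Fin (n + 1))
    (A : L.upper) : L.RInvertible k A ↔ ∃ B : L.upper,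
      L.face k true A = L.face k false B ∧ L.face k true B = L.face k false A ∧
      L.cmp k A B = L.deg k (L.face k false A) ∧ L.cmp k B A = L.deg k (L.face k true A) := by
  refine exists_congr fun B => ⟨fun ⟨h, h', e, e'⟩ => ⟨h, h', ?_, ?_⟩,
    fun ⟨h, h', e, e'⟩ => ⟨h, h', ?_, ?_⟩⟩
  · rw [cmp, dif_pos h, e]
  · rw [cmp, dif_pos h', e']
  · rw [← e, cmp, dif_pos h]
  · rw [← e', cmp, dif_pos h']

namespace CubicalOmegaCat

variable (C : CubicalOmegaCat.{u})

open Classical in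
/-- Composition as a total function; its value is `a` if `a` and `b` are not composable. -/
noncomputable def cmp {n : ℕ} (i : Fin (n + 1)) (a b : C.cells (n + 1)) : C.cells (n + 1) :=
  if h : C.face i true a = C.face i false b then C.comp i a b h else a

variable {C}

theorem cmp_eq {n : ℕ} {i : Fin (n + 1)} {a b : C.cells (n + 1)}
    (h : C.face i true a = C.face i false b) : C.cmp i a b = C.comp i a b h :=
  dif_pos h

theorem face_cmp_minus {n : ℕ} (i : Fin (n + 1)) (a b : C.cells (n + 1))
    (h : C.face i true a = C.face i false b) : C.face i false (C.cmp i a b) = C.face i false a := by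
  rw [cmp_eq h, C.face_comp_minus]

theorem face_cmp_plus {n : ℕ} (i : Fin (n + 1)) (a b : C.cells (n + 1))
    (h : C.face i true a = C.face i false b) : C.face i true (C.cmp i a b) = C.face i true b := by
  rw [cmp_eq h, C.face_comp_plus]

theorem face_cmp_lt {n : ℕ} (i j : Fin (n + 1)) (α : Bool) (a b : C.cells (n + 2)) (hij : i ≤ j)
    (h : C.face j.succ true a = C.face j.succ false b) :
    C.face i.castSucc α (C.cmp j.succ a b) =
      C.cmp j (C.face i.castSucc α a) (C.face i.castSucc α b) := by
  rw [cmp_eq h, cmp_eq (C.face_composable_lt i j α a b hij h), C.face_comp_lt i j α a b hij]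

theorem face_cmp_gt {n : ℕ} (i j : Fin (n + 1)) (α : Bool) (a b : C.cells (n + 2)) (hji : j ≤ i)
    (h : C.face j.castSucc true a = C.face j.castSucc false b) :
    C.face i.succ α (C.cmp j.castSucc a b) = C.cmp j (C.face i.succ α a) (C.face i.succ α b) := by
  rw [cmp_eq h, cmp_eq (C.face_composable_gt i j α a b hji h), C.face_comp_gt i j α a b hji]

theorem composable_deg {n : ℕ} (i : Fin (n + 2)) (j : Fin (n + 1)) {a b : C.cells (n + 1)}
    (h : C.face j true a = C.face j false b) :
    C.face (i.succAbove j) true (C.deg i a) = C.face (i.succAbove j) false (C.deg i b) := by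
  rcases Fin.castSucc_lt_or_lt_succ i j with h' | h'
  · rw [Fin.succAbove_of_castSucc_lt _ _ h']
    obtain ⟨i, rfl⟩ := Fin.exists_succ_eq.2 (Fin.ne_zero_of_lt h')
    have := Fin.castSucc_lt_succ_iff.1 h'
    rw [C.face_deg_lt _ _ _ _ this, C.face_deg_lt _ _ _ _ this, h]
  · rw [Fin.succAbove_of_lt_succ _ _ h']
    obtain ⟨i, rfl⟩ := Fin.exists_castSucc_eq.2 (Fin.ne_last_of_lt h')
    have := Fin.castSucc_lt_succ_iff.1 h'
    rw [C.face_deg_gt _ _ _ _ this, C.face_deg_gt _ _ _ _ this, h]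

theorem deg_cmp {n : ℕ} (i : Fin (n + 2)) (j : Fin (n + 1)) (a b : C.cells (n + 1))
    (h : C.face j true a = C.face j false b) :
    C.deg i (C.cmp j a b) = C.cmp (i.succAbove j) (C.deg i a) (C.deg i b) := by
  rw [cmp_eq h, cmp_eq (composable_deg i j h), C.deg_comp]

theorem composable_conn {n : ℕ} {i j : Fin (n + 1)} (α : Bool) {a b : C.cells (n + 1)}
    (hji : j < i) (h : C.face j true a = C.face j false b) :
    C.face j.castSucc true (C.conn i α a) = C.face j.castSucc false (C.conn i α b) := by
  cases n with
  | zero => omega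
  | succ n =>
  obtain ⟨i, rfl⟩ := Fin.exists_succ_eq.2 (Fin.ne_zero_of_lt hji)
  obtain ⟨j, rfl⟩ := Fin.exists_castSucc_eq.2 (Fin.ne_last_of_lt hji)
  have := Fin.castSucc_lt_succ_iff.1 hji
  rw [C.face_conn_lt _ _ _ _ _ this, C.face_conn_lt _ _ _ _ _ this, h]

theorem conn_cmp_gt {n : ℕ} (i j : Fin (n + 1)) (α : Bool) (a b : C.cells (n + 1)) (hji : j < i)
    (h : C.face j true a = C.face j false b) :
    C.conn i α (C.cmp j a b) = C.cmp j.castSucc (C.conn i α a) (C.conn i α b) := by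
  rw [cmp_eq h, cmp_eq (composable_conn α hji h), C.conn_comp_gt _ _ _ _ _ hji]

theorem cmp_deg {n : ℕ} (i : Fin (n + 1)) (a : C.cells (n + 1)) (x : C.cells n)
    (h : C.face i true a = x) : C.cmp i a (C.deg i x) = a := by
  subst h
  rw [cmp_eq (C.face_deg_self _ _ _).symm, C.comp_deg]

theorem deg_cmp_self {n : ℕ} (i : Fin (n + 1)) (a : C.cells (n + 1)) (x : C.cells n)
    (h : C.face i false a = x) : C.cmp i (C.deg i x) a = a := by
  subst h
  rw [cmp_eq (C.face_deg_self _ _ _), C.deg_comp_self]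

theorem cmp_assoc {n : ℕ} (i : Fin (n + 1)) (a b c : C.cells (n + 1))
    (h₁ : C.face i true a = C.face i false b) (h₂ : C.face i true b = C.face i false c) :
    C.cmp i (C.cmp i a b) c = C.cmp i a (C.cmp i b c) := by
  have h₃ : C.face i true (C.cmp i a b) = C.face i false c := by rw [face_cmp_plus _ _ _ h₁, h₂]
  have h₄ : C.face i true a = C.face i false (C.cmp i b c) := by rw [face_cmp_minus _ _ _ h₂, h₁]
  rw [cmp_eq h₃, cmp_eq h₄]
  simp only [cmp_eq h₁, cmp_eq h₂]
  rw [C.comp_assoc]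

theorem composable_cmp {n : ℕ} {i j : Fin (n + 1)} (hij : i ≠ j) {a b c d : C.cells (n + 1)}
    (hab : C.face i true a = C.face i false b) (hcd : C.face i true c = C.face i false d)
    (hac : C.face j true a = C.face j false c) (hbd : C.face j true b = C.face j false d) :
    C.face j true (C.cmp i a b) = C.face j false (C.cmp i c d) := by
  cases n with
  | zero => omega
  | succ n =>
  rcases lt_or_gt_of_ne hij with h | h
  · obtain ⟨j, rfl⟩ := Fin.exists_succ_eq.2 (Fin.ne_zero_of_lt h)
    obtain ⟨i, rfl⟩ := Fin.exists_castSucc_eq.2 (Fin.ne_last_of_lt h)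
    have := Fin.castSucc_lt_succ_iff.1 h
    rw [face_cmp_gt _ _ _ _ _ this hab, face_cmp_gt _ _ _ _ _ this hcd, hac, hbd]
  · obtain ⟨i, rfl⟩ := Fin.exists_succ_eq.2 (Fin.ne_zero_of_lt h)
    obtain ⟨j, rfl⟩ := Fin.exists_castSucc_eq.2 (Fin.ne_last_of_lt h)
    have := Fin.castSucc_lt_succ_iff.1 h
    rw [face_cmp_lt _ _ _ _ _ this hab, face_cmp_lt _ _ _ _ _ this hcd, hac, hbd]

theorem cmp_interchange {n : ℕ} (i j : Fin (n + 1)) (hij : i ≠ j) (a b c d : C.cells (n + 1))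
    (hab : C.face i true a = C.face i false b) (hcd : C.face i true c = C.face i false d)
    (hac : C.face j true a = C.face j false c) (hbd : C.face j true b = C.face j false d) :
    C.cmp j (C.cmp i a b) (C.cmp i c d) = C.cmp i (C.cmp j a c) (C.cmp j b d) := by
  rw [cmp_eq (composable_cmp hij hab hcd hac hbd), cmp_eq (composable_cmp hij.symm hac hbd hab hcd)]
  simp only [cmp_eq hab, cmp_eq hcd, cmp_eq hac, cmp_eq hbd]
  rw [C.interchange _ _ _ _ _ _ hij]

theorem conn_cmp_conn_castSucc {n : ℕ} (i : Fin n) (a : C.cells n) :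
    C.cmp i.castSucc (C.conn i true a) (C.conn i false a) = C.deg i.succ a := by
  have h : C.face i.castSucc true (C.conn i true a) = C.face i.castSucc false (C.conn i false a) := by
    rw [C.face_conn_castSucc, C.face_conn_castSucc]
  rw [cmp_eq h, C.conn_comp_conn_castSucc]

theorem conn_cmp_conn_succ {n : ℕ} (i : Fin n) (a : C.cells n) :
    C.cmp i.succ (C.conn i true a) (C.conn i false a) = C.deg i.castSucc a := by
  have h : C.face i.succ true (C.conn i true a) = C.face i.succ false (C.conn i false a) := by
    rw [C.face_conn_succ, C.face_conn_succ]
  rw [cmp_eq h, C.conn_comp_conn_succ]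

/-- `B` is an inverse of `A` for `⋆_k`. -/
def RInverse {n : ℕ} (k : Fin (n + 1)) (A B : C.cells (n + 1)) : Prop :=
  C.face k true A = C.face k false B ∧ C.face k true B = C.face k false A ∧
    C.cmp k A B = C.deg k (C.face k false A) ∧ C.cmp k B A = C.deg k (C.face k true A)

theorem rInvertible_iff {n : ℕ} (k : Fin (n + 1)) (A : C.cells (n + 1)) :
    RInvertible k A ↔ ∃ B, RInverse k A B :=
  (C.level n).rInvertible_iff k A

theorem RInverse.unique {n : ℕ} {k : Fin (n + 1)} {A B B' : C.cells (n + 1)}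
    (h : RInverse k A B) (h' : RInverse k A B') : B = B' := by
  obtain ⟨h₁, h₂, h₃, h₄⟩ := h
  obtain ⟨k₁, k₂, k₃, k₄⟩ := h'
  rw [← cmp_deg k B _ h₂, ← k₃, ← cmp_assoc _ _ _ _ h₂ k₁, h₄, deg_cmp_self _ _ _ k₁.symm]

theorem psi_eq {n : ℕ} (i : Fin n) (A : C.cells (n + 1)) :
    psi i A = C.cmp i.succ (C.cmp i.succ (C.conn i true (C.face i.succ false A)) A)
      (C.conn i false (C.face i.succ true A)) := by
  have h₁ : C.face i.succ true (C.conn i true (C.face i.succ false A)) = C.face i.succ false A :=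
    C.face_conn_succ i true _
  have h₂ : C.face i.succ true (C.cmp i.succ (C.conn i true (C.face i.succ false A)) A) =
      C.face i.succ false (C.conn i false (C.face i.succ true A)) := by
    rw [face_cmp_plus _ _ _ h₁, C.face_conn_succ]
  rw [cmp_eq h₂]
  simp only [cmp_eq h₁]
  rfl

end CubicalOmegaCat

/-! ### A common setting for cells and shells: inverses, connections and foldings. -/

namespace CubicalOmegaCat

/-- The cells of dimension `m + 2` of a cubical category of dimension at least `m + 2` which
coincides with `C` in dimensions at most `m + 1`, with the operations relating them to the
`(m + 1)`-cells.  Compositions are total functions. -/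
structure Layer (C : CubicalOmegaCat.{u}) (m : ℕ) where
  upper : Type u
  face : Fin (m + 2) → Bool → upper → C.cells (m + 1)
  deg : Fin (m + 2) → C.cells (m + 1) → upper
  conn : Fin (m + 1) → Bool → C.cells (m + 1) → upper
  cmp : Fin (m + 2) → upper → upper → upper
  face_face : ∀ (i j : Fin (m + 1)) (α β : Bool) (x : upper), i ≤ j →
    C.face i α (face j.succ β x) = C.face j β (face i.castSucc α x)
  deg_deg : ∀ (i j : Fin (m + 1)) (x : C.cells m), i ≤ j →
    deg i.castSucc (C.deg j x) = deg j.succ (C.deg i x)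
  face_deg_self : ∀ (i : Fin (m + 2)) (α : Bool) (x : C.cells (m + 1)), face i α (deg i x) = x
  face_deg_lt : ∀ (i j : Fin (m + 1)) (α : Bool) (x : C.cells (m + 1)), i ≤ j →
    face i.castSucc α (deg j.succ x) = C.deg j (C.face i α x)
  face_deg_gt : ∀ (i j : Fin (m + 1)) (α : Bool) (x : C.cells (m + 1)), j ≤ i →
    face i.succ α (deg j.castSucc x) = C.deg j (C.face i α x)
  face_conn_castSucc : ∀ (j : Fin (m + 1)) (α : Bool) (x : C.cells (m + 1)),
    face j.castSucc α (conn j α x) = x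
  face_conn_succ : ∀ (j : Fin (m + 1)) (α : Bool) (x : C.cells (m + 1)),
    face j.succ α (conn j α x) = x
  face_conn_castSucc_not : ∀ (j : Fin (m + 1)) (α : Bool) (x : C.cells (m + 1)),
    face j.castSucc α (conn j (!α) x) = C.deg j (C.face j α x)
  face_conn_succ_not : ∀ (j : Fin (m + 1)) (α : Bool) (x : C.cells (m + 1)),
    face j.succ α (conn j (!α) x) = C.deg j (C.face j α x)
  face_conn_lt : ∀ (i j : Fin m) (α β : Bool) (x : C.cells (m + 1)), i ≤ j →
    face i.castSucc.castSucc α (conn j.succ β x) = C.conn j β (C.face i.castSucc α x)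
  conn_deg_gt : ∀ (i j : Fin m) (α : Bool) (x : C.cells m), j ≤ i →
    conn i.succ α (C.deg j.castSucc x) = deg j.castSucc.castSucc (C.conn i α x)
  face_cmp_minus : ∀ (i : Fin (m + 2)) (a b : upper), face i true a = face i false b →
    face i false (cmp i a b) = face i false a
  face_cmp_plus : ∀ (i : Fin (m + 2)) (a b : upper), face i true a = face i false b →
    face i true (cmp i a b) = face i true b
  face_cmp_lt : ∀ (i j : Fin (m + 1)) (α : Bool) (a b : upper), i ≤ j →
    face j.succ true a = face j.succ false b →
    face i.castSucc α (cmp j.succ a b) = C.cmp j (face i.castSucc α a) (face i.castSucc α b)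
  face_cmp_gt : ∀ (i j : Fin (m + 1)) (α : Bool) (a b : upper), j ≤ i →
    face j.castSucc true a = face j.castSucc false b →
    face i.succ α (cmp j.castSucc a b) = C.cmp j (face i.succ α a) (face i.succ α b)
  deg_cmp : ∀ (i : Fin (m + 2)) (j : Fin (m + 1)) (a b : C.cells (m + 1)),
    C.face j true a = C.face j false b →
    deg i (C.cmp j a b) = cmp (i.succAbove j) (deg i a) (deg i b)
  conn_cmp_gt : ∀ (i j : Fin (m + 1)) (α : Bool) (a b : C.cells (m + 1)), j < i →
    C.face j true a = C.face j false b →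
    conn i α (C.cmp j a b) = cmp j.castSucc (conn i α a) (conn i α b)
  cmp_deg : ∀ (i : Fin (m + 2)) (a : upper) (x : C.cells (m + 1)), face i true a = x →
    cmp i a (deg i x) = a
  deg_cmp_self : ∀ (i : Fin (m + 2)) (a : upper) (x : C.cells (m + 1)), face i false a = x →
    cmp i (deg i x) a = a
  cmp_assoc : ∀ (i : Fin (m + 2)) (a b c : upper), face i true a = face i false b →
    face i true b = face i false c → cmp i (cmp i a b) c = cmp i a (cmp i b c)
  cmp_interchange : ∀ (i j : Fin (m + 2)), i ≠ j → ∀ a b c d : upper,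
    face i true a = face i false b → face i true c = face i false d →
    face j true a = face j false c → face j true b = face j false d →
    cmp j (cmp i a b) (cmp i c d) = cmp i (cmp j a c) (cmp j b d)
  conn_cmp_conn_castSucc : ∀ (i : Fin (m + 1)) (a : C.cells (m + 1)),
    cmp i.castSucc (conn i true a) (conn i false a) = deg i.succ a
  conn_cmp_conn_succ : ∀ (i : Fin (m + 1)) (a : C.cells (m + 1)),
    cmp i.succ (conn i true a) (conn i false a) = deg i.castSucc a

namespace Layer

variable {C : CubicalOmegaCat.{u}} {m : ℕ} (L : C.Layer m)

/-- The double category of directions `i` (vertical) and `i + 1` (horizontal). -/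
noncomputable def doubleCat (i : Fin (m + 1)) : ConnDoubleCat (C.cells m) (C.cells (m + 1)) L.upper where
  src := C.face i false
  tgt := C.face i true
  one := C.deg i
  mul := C.cmp i
  src_one := C.face_deg_self i false
  tgt_one := C.face_deg_self i true
  src_mul := CubicalOmegaCat.face_cmp_minus i
  tgt_mul := CubicalOmegaCat.face_cmp_plus i
  one_mul := CubicalOmegaCat.deg_cmp_self i
  mul_one := CubicalOmegaCat.cmp_deg i
  mul_assoc := CubicalOmegaCat.cmp_assoc i
  top := L.face i.castSucc false
  bot := L.face i.castSucc true
  left := L.face i.succ false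
  right := L.face i.succ true
  src_left a := L.face_face i i false false a le_rfl
  src_right a := L.face_face i i false true a le_rfl
  tgt_left a := L.face_face i i true false a le_rfl
  tgt_right a := L.face_face i i true true a le_rfl
  vid := L.deg i.castSucc
  hid := L.deg i.succ
  top_vid := L.face_deg_self _ _
  bot_vid := L.face_deg_self _ _
  left_vid f := L.face_deg_gt i i _ f le_rfl
  right_vid f := L.face_deg_gt i i _ f le_rfl
  top_hid f := L.face_deg_lt i i _ f le_rfl
  bot_hid f := L.face_deg_lt i i _ f le_rfl
  left_hid := L.face_deg_self _ _
  right_hid := L.face_deg_self _ _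
  hid_one a := (L.deg_deg i i a le_rfl).symm
  v := L.cmp i.castSucc
  h := L.cmp i.succ
  top_v := L.face_cmp_minus _
  bot_v := L.face_cmp_plus _
  left_v a b := L.face_cmp_gt i i _ a b le_rfl
  right_v a b := L.face_cmp_gt i i _ a b le_rfl
  top_h a b := L.face_cmp_lt i i _ a b le_rfl
  bot_h a b := L.face_cmp_lt i i _ a b le_rfl
  left_h := L.face_cmp_minus _
  right_h := L.face_cmp_plus _
  vid_v := L.deg_cmp_self _
  v_vid := L.cmp_deg _
  hid_h := L.deg_cmp_self _
  h_hid := L.cmp_deg _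
  v_assoc := L.cmp_assoc _
  h_assoc := L.cmp_assoc _
  interchange := L.cmp_interchange _ _ (Fin.castSucc_lt_succ (i := i)).ne'
  vid_mul f g h := by rw [L.deg_cmp _ _ _ _ h, Fin.succAbove_castSucc_self]
  hid_mul f g h := by rw [L.deg_cmp _ _ _ _ h, Fin.succAbove_succ_self]
  cp := L.conn i true
  cm := L.conn i false
  top_cp := L.face_conn_castSucc_not i false
  left_cp := L.face_conn_succ_not i false
  bot_cp := L.face_conn_castSucc i true
  right_cp := L.face_conn_succ i true
  top_cm := L.face_conn_castSucc i false
  left_cm := L.face_conn_succ i false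
  bot_cm := L.face_conn_castSucc_not i true
  right_cm := L.face_conn_succ_not i true
  v_cp_cm := L.conn_cmp_conn_castSucc i
  h_cp_cm := L.conn_cmp_conn_succ i

/-- `B` is an inverse of `A` for `⋆_k`. -/
def RInverse (k : Fin (m + 2)) (A B : L.upper) : Prop :=
  L.face k true A = L.face k false B ∧ L.face k true B = L.face k false A ∧
    L.cmp k A B = L.deg k (L.face k false A) ∧ L.cmp k B A = L.deg k (L.face k true A)

/-- The folding operation `ψ_i`. -/
def psi (i : Fin (m + 1)) (A : L.upper) : L.upper :=
  L.cmp i.succ (L.cmp i.succ (L.conn i true (L.face i.succ false A)) A)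
    (L.conn i false (L.face i.succ true A))

variable {L}

theorem RInverse.face_succ {k j : Fin (m + 1)} (hkj : k ≤ j) {A B : L.upper}
    (h : L.RInverse k.castSucc A B) (α : Bool) :
    CubicalOmegaCat.RInverse k (L.face j.succ α A) (L.face j.succ α B) := by
  obtain ⟨h₁, h₂, h₃, h₄⟩ := h
  refine ⟨?_, ?_, ?_, ?_⟩
  · rw [L.face_face _ _ _ _ _ hkj, L.face_face _ _ _ _ _ hkj, h₁]
  · rw [L.face_face _ _ _ _ _ hkj, L.face_face _ _ _ _ _ hkj, h₂]
  · rw [← L.face_cmp_gt _ _ _ _ _ hkj h₁, h₃, L.face_deg_gt _ _ _ _ hkj, L.face_face _ _ _ _ _ hkj]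
  · rw [← L.face_cmp_gt _ _ _ _ _ hkj h₂, h₄, L.face_deg_gt _ _ _ _ hkj, L.face_face _ _ _ _ _ hkj]

theorem RInverse.cmp_self {k : Fin (m + 2)} {a a' b b' : L.upper} (ha : L.RInverse k a a')
    (hb : L.RInverse k b b') (h : L.face k true a = L.face k false b) :
    L.RInverse k (L.cmp k a b) (L.cmp k b' a') := by
  obtain ⟨h₁, h₂, h₃, h₄⟩ := ha
  obtain ⟨k₁, k₂, k₃, k₄⟩ := hb
  have h' : L.face k true b' = L.face k false a' := by rw [k₂, ← h₁, h]
  refine ⟨?_, ?_, ?_, ?_⟩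
  · rw [L.face_cmp_plus _ _ _ h, L.face_cmp_minus _ _ _ h', k₁]
  · rw [L.face_cmp_minus _ _ _ h, L.face_cmp_plus _ _ _ h', h₂]
  · rw [L.cmp_assoc _ _ _ _ h (by rw [L.face_cmp_minus _ _ _ h', k₁]),
      ← L.cmp_assoc _ _ _ _ k₁ h', k₃, L.deg_cmp_self _ _ _ (by rw [← h₁, h]), h₃,
      L.face_cmp_minus _ _ _ h]
  · rw [L.cmp_assoc _ _ _ _ h' (by rw [L.face_cmp_minus _ _ _ h, h₂]),
      ← L.cmp_assoc _ _ _ _ h₂ h, h₄, L.deg_cmp_self _ _ _ (by rw [h]), k₄,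
      L.face_cmp_plus _ _ _ h]

/-- Interchange reduces inversion of a composite in another direction to that of its factors. -/
theorem RInverse.cmp_succ {k j : Fin (m + 1)} (hkj : k ≤ j) {a a' b b' : L.upper}
    (ha : L.RInverse k.castSucc a a') (hb : L.RInverse k.castSucc b b')
    (h : L.face j.succ true a = L.face j.succ false b) :
    L.RInverse k.castSucc (L.cmp j.succ a b) (L.cmp j.succ a' b') := by
  -- The inverses are composable because their adjacent faces are both inverse to the face shared by
  -- `a` and `b`.
  have h' : L.face j.succ true a' = L.face j.succ false b' :=
    (ha.face_succ hkj true).unique (h ▸ hb.face_succ hkj false)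
  have hne : j.succ ≠ k.castSucc := (Fin.castSucc_lt_succ_iff.2 hkj).ne'
  obtain ⟨h₁, h₂, h₃, h₄⟩ := ha
  obtain ⟨k₁, k₂, k₃, k₄⟩ := hb
  have hs : ∀ (α β : Bool), C.face j true (L.face k.castSucc α a) =
      C.face j false (L.face k.castSucc α b) := fun α _ => by
    rw [← L.face_face _ _ _ _ _ hkj, ← L.face_face _ _ _ _ _ hkj, h]
  have hd : k.castSucc.succAbove j = j.succ :=
    Fin.succAbove_of_le_castSucc _ _ (Fin.castSucc_le_castSucc_iff.2 hkj)
  refine ⟨?_, ?_, ?_, ?_⟩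
  · rw [L.face_cmp_lt _ _ _ _ _ hkj h, L.face_cmp_lt _ _ _ _ _ hkj h', h₁, k₁]
  · rw [L.face_cmp_lt _ _ _ _ _ hkj h, L.face_cmp_lt _ _ _ _ _ hkj h', h₂, k₂]
  · rw [L.cmp_interchange _ _ hne _ _ _ _ h h' h₁ k₁, h₃, k₃, L.face_cmp_lt _ _ _ _ _ hkj h,
      L.deg_cmp _ _ _ _ (hs false false), hd]
  · rw [L.cmp_interchange _ _ hne _ _ _ _ h' h h₂ k₂, h₄, k₄, L.face_cmp_lt _ _ _ _ _ hkj h,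
      L.deg_cmp _ _ _ _ (hs true true), hd]

theorem rInverse_deg (k : Fin (m + 2)) (x : C.cells (m + 1)) :
    L.RInverse k (L.deg k x) (L.deg k x) := by
  simp only [RInverse, L.face_deg_self, true_and]
  exact ⟨L.cmp_deg _ _ _ (L.face_deg_self _ _ _), L.cmp_deg _ _ _ (L.face_deg_self _ _ _)⟩

theorem rInverse_deg_succ {k j : Fin (m + 1)} (hkj : k ≤ j) {x y : C.cells (m + 1)}
    (h : CubicalOmegaCat.RInverse k x y) :
    L.RInverse k.castSucc (L.deg j.succ x) (L.deg j.succ y) := by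
  have hd : j.succ.succAbove k = k.castSucc :=
    Fin.succAbove_of_castSucc_lt _ _ (Fin.castSucc_lt_succ_iff.2 hkj)
  obtain ⟨h₁, h₂, h₃, h₄⟩ := h
  simp only [RInverse, L.face_deg_lt _ _ _ _ hkj]
  exact ⟨by rw [h₁], by rw [h₂], by rw [L.deg_deg _ _ _ hkj, ← h₃, L.deg_cmp _ _ _ _ h₁, hd],
    by rw [L.deg_deg _ _ _ hkj, ← h₄, L.deg_cmp _ _ _ _ h₂, hd]⟩

theorem rInverse_conn {k j : Fin (m + 1)} (hkj : k < j) (α : Bool) {x y : C.cells (m + 1)}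
    (h : CubicalOmegaCat.RInverse k x y) :
    L.RInverse k.castSucc (L.conn j α x) (L.conn j α y) := by
  have hc := fun a b => L.conn_cmp_gt j k α a b hkj
  cases m with
  | zero => omega
  | succ m =>
  obtain ⟨j, rfl⟩ := Fin.exists_succ_eq.2 (Fin.ne_zero_of_lt hkj)
  obtain ⟨k, rfl⟩ := Fin.exists_castSucc_eq.2 (Fin.ne_last_of_lt hkj)
  have hkj' := Fin.castSucc_lt_succ_iff.1 hkj
  obtain ⟨h₁, h₂, h₃, h₄⟩ := h
  simp only [RInverse, L.face_conn_lt _ _ _ _ _ hkj']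
  exact ⟨by rw [h₁], by rw [h₂], by rw [← L.conn_deg_gt _ _ _ _ hkj', ← h₃, hc _ _ h₁],
    by rw [← L.conn_deg_gt _ _ _ _ hkj', ← h₄, hc _ _ h₂]⟩

/-- For `k < j` the connection is compatible with `⋆_k`. For `k = j` it is not, and the inverse
comes from the double category instead. -/
theorem exists_rInverse_conn {k j : Fin (m + 1)} (hkj : k ≤ j) (α : Bool) {x y : C.cells (m + 1)}
    (h : CubicalOmegaCat.RInverse k x y) : ∃ B, L.RInverse k.castSucc (L.conn j α x) B := by
  rcases hkj.lt_or_eq with hkj | rfl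
  · exact ⟨_, rInverse_conn hkj α h⟩
  · cases α
    · exact ⟨_, ConnDoubleCat.VInverse.cm (D := L.doubleCat k) h⟩
    · exact ⟨_, ConnDoubleCat.VInverse.cp (D := L.doubleCat k) h⟩

theorem exists_rInverse_deg {k : Fin (m + 1)} {l : Fin (m + 2)} (hkl : k.castSucc ≤ l)
    {x : C.cells (m + 1)} (h : k.castSucc < l → ∃ y, CubicalOmegaCat.RInverse k x y) :
    ∃ B, L.RInverse k.castSucc (L.deg l x) B := by
  rcases hkl.lt_or_eq with hkl | rfl
  · obtain ⟨y, hy⟩ := h hkl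
    obtain ⟨l, rfl⟩ := Fin.exists_succ_eq.2 (Fin.ne_zero_of_lt hkl)
    exact ⟨_, rInverse_deg_succ (Fin.castSucc_lt_succ_iff.1 hkl) hy⟩
  · exact ⟨_, rInverse_deg _ _⟩

theorem exists_rInverse_cmp {k : Fin (m + 1)} {l : Fin (m + 2)} (hkl : k.castSucc ≤ l)
    {a b : L.upper} (ha : ∃ B, L.RInverse k.castSucc a B) (hb : ∃ B, L.RInverse k.castSucc b B)
    (h : L.face l true a = L.face l false b) : ∃ B, L.RInverse k.castSucc (L.cmp l a b) B := by
  obtain ⟨_, ha⟩ := ha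
  obtain ⟨_, hb⟩ := hb
  rcases hkl.lt_or_eq with hkl | rfl
  · obtain ⟨l, rfl⟩ := Fin.exists_succ_eq.2 (Fin.ne_zero_of_lt hkl)
    exact ⟨_, ha.cmp_succ (Fin.castSucc_lt_succ_iff.1 hkl) hb h⟩
  · exact ⟨_, ha.cmp_self hb h⟩

theorem exists_rInverse_psi {k i : Fin (m + 1)} (hki : k ≤ i) {A : L.upper}
    (h : ∃ B, L.RInverse k.castSucc A B) : ∃ B, L.RInverse k.castSucc (L.psi i A) B := by
  obtain ⟨B, hB⟩ := h
  have hl : k.castSucc ≤ i.succ := (Fin.castSucc_lt_succ_iff.2 hki).le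
  have h₁ : L.face i.succ true (L.conn i true (L.face i.succ false A)) = L.face i.succ false A :=
    L.face_conn_succ _ _ _
  refine exists_rInverse_cmp hl (exists_rInverse_cmp hl ?_ ⟨B, hB⟩ h₁) ?_ ?_
  · exact exists_rInverse_conn hki _ (hB.face_succ hki _)
  · exact exists_rInverse_conn hki _ (hB.face_succ hki _)
  · rw [L.face_cmp_plus _ _ _ h₁, L.face_conn_succ]

/-- `R_k`-invertibility of `ψ_i A` implies that of `A` when `k ≤ i` and the faces of `A` in
directions greater than `k` are `R_k`-invertible. -/
theorem exists_rInverse_of_psi {k i : Fin (m + 1)} (hki : k ≤ i) {A : L.upper}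
    (hf : ∀ (j : Fin (m + 1)) (α : Bool), k ≤ j →
      ∃ y, CubicalOmegaCat.RInverse k (L.face j.succ α A) y)
    (h : ∃ B, L.RInverse k.castSucc (L.psi i A) B) : ∃ B, L.RInverse k.castSucc A B := by
  have hl : k.castSucc ≤ i.castSucc := hki
  have hl' : k.castSucc ≤ i.succ := (Fin.castSucc_lt_succ_iff.2 hki).le
  have hdeg : ∀ α, ∃ B, L.RInverse k.castSucc (L.deg i.castSucc (L.face i.castSucc α A)) B := by
    refine fun α => exists_rInverse_deg hl fun hlt => ?_
    obtain ⟨j, hj⟩ := Fin.exists_succ_eq.2 (Fin.ne_zero_of_lt hlt)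
    rw [← hj] at hlt ⊢
    exact hf j α (Fin.castSucc_lt_succ_iff.1 hlt)
  have hconn : ∀ α β, ∃ B, L.RInverse k.castSucc (L.conn i β (L.face i.succ α A)) B := fun α β => by
    obtain ⟨y, hy⟩ := hf i α hki
    exact exists_rInverse_conn hki _ hy
  -- The unfolding is built from `ψ_i A` and from degeneracies and connections on faces of `A`, all
  -- of which are `R_k`-invertible here.
  rw [← (L.doubleCat i).unfold_fold A]
  have e₁ : (L.doubleCat i).right ((L.doubleCat i).vid ((L.doubleCat i).top A)) =
      (L.doubleCat i).left ((L.doubleCat i).cp ((L.doubleCat i).right A)) := by simp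
  have e₂ : (L.doubleCat i).right ((L.doubleCat i).cm ((L.doubleCat i).left A)) =
      (L.doubleCat i).left ((L.doubleCat i).vid ((L.doubleCat i).bot A)) := by simp
  have e₃ : (L.doubleCat i).bot ((L.doubleCat i).h ((L.doubleCat i).vid ((L.doubleCat i).top A))
      ((L.doubleCat i).cp ((L.doubleCat i).right A))) =
      (L.doubleCat i).top ((L.doubleCat i).fold A) := by simp
  have e₄ : (L.doubleCat i).bot ((L.doubleCat i).fold A) =
      (L.doubleCat i).top ((L.doubleCat i).h ((L.doubleCat i).cm ((L.doubleCat i).left A))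
        ((L.doubleCat i).vid ((L.doubleCat i).bot A))) := by simp
  refine exists_rInverse_cmp hl (exists_rInverse_cmp hl
    (exists_rInverse_cmp hl' (hdeg _) (hconn _ _) e₁) h e₃)
    (exists_rInverse_cmp hl' (hconn _ _) (hdeg _) e₂)
    (((L.doubleCat i).bot_v _ _ e₃).trans e₄)

theorem exists_rInverse_succ_iff {i : Fin (m + 1)} {A : L.upper}
    (hf : ∀ (α : Bool), ∃ y, CubicalOmegaCat.RInverse i (L.face i.castSucc α A) y) :
    (∃ B, L.RInverse i.succ A B) ↔ ∃ B, L.RInverse i.castSucc (L.psi i A) B := by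
  obtain ⟨p, hp⟩ := hf false
  obtain ⟨q, hq⟩ := hf true
  exact ConnDoubleCat.exists_hInverse_iff (D := L.doubleCat i) hp hq

theorem RInverse.face_castSucc {i : Fin (m + 1)} {A B : L.upper} (h : L.RInverse i.succ A B) :
    ∀ α, CubicalOmegaCat.RInverse i (L.face i.castSucc α A) (L.face i.castSucc α B)
  | false => ConnDoubleCat.HInverse.top (D := L.doubleCat i) h
  | true => ConnDoubleCat.HInverse.bot (D := L.doubleCat i) h

end Layer

end CubicalOmegaCat

/-! ### The layers of cells and of shells. -/

namespace CubicalOmegaCat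

variable (C : CubicalOmegaCat.{u})

/-- The cells of dimension `m + 2` of `C`. -/
noncomputable def layer (m : ℕ) : C.Layer m where
  upper := C.cells (m + 2)
  face := C.face
  deg := C.deg
  conn := C.conn
  cmp := C.cmp
  face_face := C.face_face
  deg_deg := C.deg_deg
  face_deg_self := C.face_deg_self
  face_deg_lt := C.face_deg_lt
  face_deg_gt := C.face_deg_gt
  face_conn_castSucc := C.face_conn_castSucc
  face_conn_succ := C.face_conn_succ
  face_conn_castSucc_not := C.face_conn_castSucc_not
  face_conn_succ_not := C.face_conn_succ_not
  face_conn_lt := by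
    cases m with
    | zero => exact fun i => i.elim0
    | succ m => exact C.face_conn_lt
  conn_deg_gt := C.conn_deg_gt
  face_cmp_minus := face_cmp_minus
  face_cmp_plus := face_cmp_plus
  face_cmp_lt := face_cmp_lt
  face_cmp_gt := face_cmp_gt
  deg_cmp := deg_cmp
  conn_cmp_gt := conn_cmp_gt
  cmp_deg := cmp_deg
  deg_cmp_self := deg_cmp_self
  cmp_assoc := cmp_assoc
  cmp_interchange := cmp_interchange
  conn_cmp_conn_castSucc := conn_cmp_conn_castSucc
  conn_cmp_conn_succ := conn_cmp_conn_succ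

/-- Composition of shells as a total function. -/
noncomputable def boxCmp {m : ℕ} (i : Fin (m + 2)) (a b : C.Shell (m + 1)) : C.Shell (m + 1) :=
  (C.boxLevel (m + 1)).cmp i a b

variable {C} {m : ℕ}

theorem boxCmp_eq {i : Fin (m + 2)} {a b : C.Shell (m + 1)} (h : a.1 i true = b.1 i false) :
    C.boxCmp i a b = C.shellComp i a b h :=
  dif_pos h

theorem boxCmp_self_minus {i : Fin (m + 2)} {a b : C.Shell (m + 1)}
    (h : a.1 i true = b.1 i false) : (C.boxCmp i a b).1 i false = a.1 i false := by
  rw [boxCmp_eq h]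
  simp only [shellComp, shellCompFamily, lt_irrefl, dite_false]

theorem boxCmp_self_plus {i : Fin (m + 2)} {a b : C.Shell (m + 1)}
    (h : a.1 i true = b.1 i false) : (C.boxCmp i a b).1 i true = b.1 i true := by
  rw [boxCmp_eq h]
  simp only [shellComp, shellCompFamily, lt_irrefl, dite_false]

theorem Shell.composable {j : Fin (m + 2)} {d : Fin (m + 1)} (α : Bool) {a b : C.Shell (m + 1)}
    (h : a.1 (j.succAbove d) true = b.1 (j.succAbove d) false) :
    C.face d true (a.1 j α) = C.face d false (b.1 j α) := by
  rcases Fin.castSucc_lt_or_lt_succ j d with hj | hj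
  · rw [Fin.succAbove_of_castSucc_lt _ _ hj] at h
    obtain ⟨j, rfl⟩ := Fin.exists_succ_eq.2 (Fin.ne_zero_of_lt hj)
    have hj := Fin.castSucc_lt_succ_iff.1 hj
    rw [a.2 _ _ _ _ hj, b.2 _ _ _ _ hj, h]
  · rw [Fin.succAbove_of_lt_succ _ _ hj] at h
    obtain ⟨j, rfl⟩ := Fin.exists_castSucc_eq.2 (Fin.ne_last_of_lt hj)
    have hj := Fin.castSucc_lt_succ_iff.1 hj
    rw [← a.2 _ _ _ _ hj, ← b.2 _ _ _ _ hj, h]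

/-- Writing a direction other than `j` as `j.succAbove d` merges the cases below and above `j`: in
both, components are composed in direction `d`. -/
theorem boxCmp_succAbove {j : Fin (m + 2)} {d : Fin (m + 1)} (α : Bool) {a b : C.Shell (m + 1)}
    (h : a.1 (j.succAbove d) true = b.1 (j.succAbove d) false) :
    (C.boxCmp (j.succAbove d) a b).1 j α = C.cmp d (a.1 j α) (b.1 j α) := by
  rw [boxCmp_eq h, cmp_eq (Shell.composable α h)]
  simp only [shellComp, shellCompFamily]
  rcases Fin.castSucc_lt_or_lt_succ j d with hj | hj
  · have hd := Fin.succAbove_of_castSucc_lt _ _ hj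
    have hj' : ¬ j < j.succAbove d := by rw [hd]; exact hj.not_gt
    have hj'' : j.succAbove d < j := by rw [hd]; exact hj
    rw [dif_neg hj', dif_pos hj'']
    congr 1
    simp only [hd, Fin.castPred_castSucc]
  · have hd := Fin.succAbove_of_lt_succ _ _ hj
    have hj' : j < j.succAbove d := by rw [hd]; exact hj
    rw [dif_pos hj']
    congr 1
    simp only [hd, Fin.pred_succ]

/-- For the unit laws it only matters that the component is degenerate in direction `d`; the index
`e` is then recovered from composability. -/
theorem shell_deg_succAbove (j : Fin (m + 2)) (d : Fin (m + 1)) (α : Bool) :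
    ∃ e : Fin (m + 1), ∀ x : C.cells (m + 1), (C.shell (C.deg (j.succAbove d) x)).1 j α =
      C.deg d (C.face e α x) := by
  rcases Fin.castSucc_lt_or_lt_succ j d with hj | hj
  · rw [Fin.succAbove_of_castSucc_lt _ _ hj]
    obtain ⟨j, rfl⟩ := Fin.exists_succ_eq.2 (Fin.ne_zero_of_lt hj)
    exact ⟨j, fun x => C.face_deg_gt _ _ _ _ (Fin.castSucc_lt_succ_iff.1 hj)⟩
  · rw [Fin.succAbove_of_lt_succ _ _ hj]
    obtain ⟨j, rfl⟩ := Fin.exists_castSucc_eq.2 (Fin.ne_last_of_lt hj)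
    exact ⟨j, fun x => C.face_deg_lt _ _ _ _ (Fin.castSucc_lt_succ_iff.1 hj)⟩

theorem Shell.ext {a b : C.Shell (m + 1)} (h : ∀ i α, a.1 i α = b.1 i α) : a = b :=
  Subtype.ext (funext fun i => funext fun α => h i α)

/-- Taking shells preserves composites. This transports to shells the laws about degeneracies and
connections, and later the foldings. -/
theorem shell_cmp (i : Fin (m + 2)) (a b : C.cells (m + 2))
    (h : C.face i true a = C.face i false b) :
    C.shell (C.cmp i a b) = C.boxCmp i (C.shell a) (C.shell b) := by
  refine Shell.ext fun j α => ?_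
  rcases Fin.eq_self_or_eq_succAbove j i with rfl | ⟨d, rfl⟩
  · cases α
    · exact (face_cmp_minus _ _ _ h).trans (boxCmp_self_minus (a := C.shell a) (b := C.shell b) h).symm
    · exact (face_cmp_plus _ _ _ h).trans (boxCmp_self_plus (a := C.shell a) (b := C.shell b) h).symm
  · refine Eq.trans ?_ (boxCmp_succAbove (a := C.shell a) (b := C.shell b) α h).symm
    simp only [shell]
    rcases Fin.castSucc_lt_or_lt_succ j d with hj | hj
    · rw [Fin.succAbove_of_castSucc_lt _ _ hj] at h ⊢
      obtain ⟨j, rfl⟩ := Fin.exists_succ_eq.2 (Fin.ne_zero_of_lt hj)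
      exact face_cmp_gt _ _ _ _ _ (Fin.castSucc_lt_succ_iff.1 hj) h
    · rw [Fin.succAbove_of_lt_succ _ _ hj] at h ⊢
      obtain ⟨j, rfl⟩ := Fin.exists_castSucc_eq.2 (Fin.ne_last_of_lt hj)
      exact face_cmp_lt _ _ _ _ _ (Fin.castSucc_lt_succ_iff.1 hj) h

theorem boxCmp_deg (i : Fin (m + 2)) (a : C.Shell (m + 1)) (x : C.cells (m + 1))
    (h : a.1 i true = x) : C.boxCmp i a (C.shell (C.deg i x)) = a := by
  have hc : a.1 i true = (C.shell (C.deg i x)).1 i false := h.trans (C.face_deg_self _ _ _).symm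
  refine Shell.ext fun j α => ?_
  rcases Fin.eq_self_or_eq_succAbove j i with rfl | ⟨d, rfl⟩
  · cases α
    · rw [boxCmp_self_minus hc]
    · rw [boxCmp_self_plus hc, h]
      exact C.face_deg_self _ _ _
  · obtain ⟨e, he⟩ := shell_deg_succAbove (C := C) j d α
    have hx := Shell.composable α hc
    rw [he, C.face_deg_self] at hx
    rw [boxCmp_succAbove α hc, he, cmp_deg _ _ _ hx]

theorem deg_boxCmp (i : Fin (m + 2)) (a : C.Shell (m + 1)) (x : C.cells (m + 1))
    (h : a.1 i false = x) : C.boxCmp i (C.shell (C.deg i x)) a = a := by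
  have hc : (C.shell (C.deg i x)).1 i true = a.1 i false := (C.face_deg_self _ _ _).trans h.symm
  refine Shell.ext fun j α => ?_
  rcases Fin.eq_self_or_eq_succAbove j i with rfl | ⟨d, rfl⟩
  · cases α
    · rw [boxCmp_self_minus hc, h]
      exact C.face_deg_self _ _ _
    · rw [boxCmp_self_plus hc]
  · obtain ⟨e, he⟩ := shell_deg_succAbove (C := C) j d α
    have hx := Shell.composable α hc
    rw [he, C.face_deg_self] at hx
    rw [boxCmp_succAbove α hc, he, deg_cmp_self _ _ _ hx.symm]

theorem boxCmp_assoc (i : Fin (m + 2)) (a b c : C.Shell (m + 1)) (h₁ : a.1 i true = b.1 i false)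
    (h₂ : b.1 i true = c.1 i false) :
    C.boxCmp i (C.boxCmp i a b) c = C.boxCmp i a (C.boxCmp i b c) := by
  have h₃ : (C.boxCmp i a b).1 i true = c.1 i false := by rw [boxCmp_self_plus h₁, h₂]
  have h₄ : a.1 i true = (C.boxCmp i b c).1 i false := by rw [boxCmp_self_minus h₂, h₁]
  refine Shell.ext fun j α => ?_
  rcases Fin.eq_self_or_eq_succAbove j i with rfl | ⟨d, rfl⟩
  · cases α
    · rw [boxCmp_self_minus h₃, boxCmp_self_minus h₄, boxCmp_self_minus h₁]
    · rw [boxCmp_self_plus h₃, boxCmp_self_plus h₄, boxCmp_self_plus h₂]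
  · rw [boxCmp_succAbove α h₃, boxCmp_succAbove α h₄, boxCmp_succAbove α h₁,
      boxCmp_succAbove α h₂, cmp_assoc _ _ _ _ (Shell.composable α h₁) (Shell.composable α h₂)]

theorem boxCmp_composable {i j : Fin (m + 2)} (hij : i ≠ j) {a b c d : C.Shell (m + 1)}
    (hab : a.1 i true = b.1 i false) (hcd : c.1 i true = d.1 i false)
    (hac : a.1 j true = c.1 j false) (hbd : b.1 j true = d.1 j false) :
    (C.boxCmp i a b).1 j true = (C.boxCmp i c d).1 j false := by
  obtain ⟨e, rfl⟩ := Fin.exists_succAbove_eq hij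
  rw [boxCmp_succAbove _ hab, boxCmp_succAbove _ hcd, hac, hbd]

/-- Only components in directions different from both `i` and `j` need the interchange law of `C`;
the others hold by the formulas for faces of composites. -/
theorem boxCmp_interchange (i j : Fin (m + 2)) (hij : i ≠ j) (a b c d : C.Shell (m + 1))
    (hab : a.1 i true = b.1 i false) (hcd : c.1 i true = d.1 i false)
    (hac : a.1 j true = c.1 j false) (hbd : b.1 j true = d.1 j false) :
    C.boxCmp j (C.boxCmp i a b) (C.boxCmp i c d) =
      C.boxCmp i (C.boxCmp j a c) (C.boxCmp j b d) := by
  have h₁ := boxCmp_composable hij hab hcd hac hbd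
  have h₂ := boxCmp_composable hij.symm hac hbd hab hcd
  refine Shell.ext fun k α => ?_
  rcases Fin.eq_self_or_eq_succAbove k i with rfl | ⟨i, rfl⟩
  · obtain ⟨e, rfl⟩ := Fin.exists_succAbove_eq hij.symm
    rw [boxCmp_succAbove _ h₁]
    cases α
    · rw [boxCmp_self_minus h₂, boxCmp_self_minus hab, boxCmp_self_minus hcd,
        boxCmp_succAbove _ hac]
    · rw [boxCmp_self_plus h₂, boxCmp_self_plus hab, boxCmp_self_plus hcd,
        boxCmp_succAbove _ hbd]
  rcases Fin.eq_self_or_eq_succAbove k j with rfl | ⟨j, rfl⟩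
  · rw [boxCmp_succAbove _ h₂]
    cases α
    · rw [boxCmp_self_minus h₁, boxCmp_self_minus hac, boxCmp_self_minus hbd,
        boxCmp_succAbove _ hab]
    · rw [boxCmp_self_plus h₁, boxCmp_self_plus hac, boxCmp_self_plus hbd,
        boxCmp_succAbove _ hcd]
  · have hij' : i ≠ j := fun h => hij (h ▸ rfl)
    rw [boxCmp_succAbove _ h₁, boxCmp_succAbove _ h₂, boxCmp_succAbove _ hab,
      boxCmp_succAbove _ hcd, boxCmp_succAbove _ hac, boxCmp_succAbove _ hbd,
      cmp_interchange _ _ hij' _ _ _ _ (Shell.composable α hab) (Shell.composable α hcd)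
        (Shell.composable α hac) (Shell.composable α hbd)]

variable (C)

/-- The cells of dimension `m + 2` of `□_{m+1} C`. -/
noncomputable def boxLayer (m : ℕ) : C.Layer m where
  upper := C.Shell (m + 1)
  face i α a := a.1 i α
  deg i x := C.shell (C.deg i x)
  conn i α x := C.shell (C.conn i α x)
  cmp := C.boxCmp
  face_face i j α β x h := x.2 i j α β h
  deg_deg i j x h := congrArg C.shell (C.deg_deg i j x h)
  face_deg_self := C.face_deg_self
  face_deg_lt := C.face_deg_lt
  face_deg_gt := C.face_deg_gt
  face_conn_castSucc := C.face_conn_castSucc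
  face_conn_succ := C.face_conn_succ
  face_conn_castSucc_not := C.face_conn_castSucc_not
  face_conn_succ_not := C.face_conn_succ_not
  face_conn_lt := (C.layer m).face_conn_lt
  conn_deg_gt i j α x h := congrArg C.shell (C.conn_deg_gt i j α x h)
  face_cmp_minus _ _ _ := boxCmp_self_minus
  face_cmp_plus _ _ _ := boxCmp_self_plus
  face_cmp_lt i j α a b hij h := by
    have hd : i.castSucc.succAbove j = j.succ :=
      Fin.succAbove_of_le_castSucc _ _ (Fin.castSucc_le_castSucc_iff.2 hij)
    rw [← hd] at h ⊢
    exact boxCmp_succAbove α h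
  face_cmp_gt i j α a b hji h := by
    have hd : i.succ.succAbove j = j.castSucc :=
      Fin.succAbove_of_castSucc_lt _ _ (Fin.castSucc_lt_succ_iff.2 hji)
    rw [← hd] at h ⊢
    exact boxCmp_succAbove α h
  deg_cmp i j a b h := by
    rw [CubicalOmegaCat.deg_cmp _ _ _ _ h, shell_cmp _ _ _ (composable_deg i j h)]
  conn_cmp_gt i j α a b hji h := by
    rw [CubicalOmegaCat.conn_cmp_gt _ _ _ _ _ hji h, shell_cmp _ _ _ (composable_conn α hji h)]
  cmp_deg := boxCmp_deg
  deg_cmp_self := deg_boxCmp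
  cmp_assoc := boxCmp_assoc
  cmp_interchange := boxCmp_interchange
  conn_cmp_conn_castSucc i a := by
    rw [← CubicalOmegaCat.conn_cmp_conn_castSucc, shell_cmp]
    rw [C.face_conn_castSucc, C.face_conn_castSucc]
  conn_cmp_conn_succ i a := by
    rw [← CubicalOmegaCat.conn_cmp_conn_succ, shell_cmp]
    rw [C.face_conn_succ, C.face_conn_succ]

/-! ### T-invertibility as R-invertibility of the folding, for cells and shells. -/

variable {C}

theorem shell_psi (i : Fin (m + 1)) (A : C.cells (m + 2)) :
    C.shell (psi i A) = (C.boxLayer m).psi i (C.shell A) := by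
  have h₁ : C.face i.succ true (C.conn i true (C.face i.succ false A)) = C.face i.succ false A :=
    C.face_conn_succ i true _
  have h₂ : C.face i.succ true (C.cmp i.succ (C.conn i true (C.face i.succ false A)) A) =
      C.face i.succ false (C.conn i false (C.face i.succ true A)) := by
    rw [face_cmp_plus _ _ _ h₁, C.face_conn_succ]
  rw [psi_eq, shell_cmp _ _ _ h₂, shell_cmp _ _ _ h₁]
  rfl

theorem hasRInvertibleShell_iff (k : Fin (m + 2)) (A : C.cells (m + 2)) :
    HasRInvertibleShell k A ↔ ∃ B, (C.boxLayer m).RInverse k (C.shell A) B :=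
  (C.boxLevel (m + 1)).rInvertible_iff k (C.shell A)

namespace Layer

variable (L : C.Layer m)

/-- The level underlying a layer. -/
def toLevel : CubicalLevel (m + 1) where
  lower := C.cells (m + 1)
  upper := L.upper
  face := L.face
  deg := L.deg
  conn := L.conn
  comp i a b _ := L.cmp i a b

/-- The composability conditions in the T-equation follow from the transposed boundaries. -/
theorem toLevel_tEquation_iff {i : Fin (m + 1)} {A B : L.upper}
    (H : (L.doubleCat i).Transposed A B) :
    L.toLevel.TEquation i A B ↔ (L.doubleCat i).TEq A B := by
  refine ⟨fun ⟨_, _, _, _, e⟩ => e, fun e => ⟨?_, ?_, ?_, ?_, e⟩⟩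
  · exact (L.face_conn_castSucc _ _ _).trans H.left
  · exact (L.face_conn_castSucc _ _ _).symm
  · have h : (L.doubleCat i).right ((L.doubleCat i).v
        ((L.doubleCat i).cp ((L.doubleCat i).left A)) B) = (L.doubleCat i).left
        ((L.doubleCat i).v A ((L.doubleCat i).cm ((L.doubleCat i).bot A))) := by
      simp [H.left, H.bot]
    exact h
  · have h : (L.doubleCat i).bot ((L.doubleCat i).cm ((L.doubleCat i).top A)) =
        (L.doubleCat i).top ((L.doubleCat i).cp ((L.doubleCat i).right A)) := by simp
    exact h

theorem toLevel_tInvertible_iff {i : Fin (m + 1)} {A : L.upper} :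
    L.toLevel.TInvertible i A ↔ ∃ B, L.RInverse i.castSucc (L.psi i A) B := by
  refine Iff.trans (exists_congr fun B => ?_) ((L.doubleCat i).exists_tInverse_iff A)
  have h : (∀ α, L.face i.castSucc α A = L.face i.succ α B ∧
      L.face i.succ α A = L.face i.castSucc α B) ↔ (L.doubleCat i).Transposed A B :=
    ⟨fun h => ⟨(h false).1, (h true).1, (h false).2, (h true).2⟩, fun h α => by
      cases α
      · exact ⟨h.top, h.left⟩
      · exact ⟨h.bot, h.right⟩⟩
  exact ⟨fun ⟨h₁, h₂, h₃⟩ => ⟨h.1 h₁, (toLevel_tEquation_iff L (h.1 h₁)).1 h₂,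
      (toLevel_tEquation_iff L (h.1 h₁).symm).1 h₃⟩,
    fun ⟨h₁, h₂, h₃⟩ => ⟨h.2 h₁, (toLevel_tEquation_iff L h₁).2 h₂,
      (toLevel_tEquation_iff L h₁.symm).2 h₃⟩⟩

end Layer

theorem tInvertible_iff (i : Fin (m + 1)) (A : C.cells (m + 2)) :
    TInvertible i A ↔ RInvertible i.castSucc (psi i A) := by
  -- Once the partial composition is replaced by the total one, the level of `C` is by definition
  -- the one underlying its layer.
  have h : @C.comp (m + 1) = fun i a b _ => C.cmp i a b := by
    funext i a b h
    exact (cmp_eq h).symm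
  rw [rInvertible_iff, psi_eq]
  refine Iff.trans ?_ (C.layer m).toLevel_tInvertible_iff
  unfold TInvertible level
  rw [h]
  rfl

theorem hasTInvertibleShell_iff (i : Fin (m + 1)) (A : C.cells (m + 2)) :
    HasTInvertibleShell i A ↔ HasRInvertibleShell i.castSucc (psi i A) := by
  have h : @shellComp C (m + 1) = fun i a b _ => C.boxCmp i a b := by
    funext i a b h
    exact (boxCmp_eq h).symm
  rw [hasRInvertibleShell_iff, shell_psi]
  refine Iff.trans ?_ (C.boxLayer m).toLevel_tInvertible_iff
  unfold HasTInvertibleShell boxLevel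
  rw [h]
  rfl

end CubicalOmegaCat

/-! ### Invertibility along sequences of foldings. -/

namespace CubicalOmegaCat

variable {C : CubicalOmegaCat.{u}} {m n : ℕ}

theorem HasRInvertibleShell.exists_face {k j : Fin (m + 1)} (hkj : k ≤ j) {A : C.cells (m + 2)}
    (h : HasRInvertibleShell k.castSucc A) (α : Bool) :
    ∃ y, RInverse k (C.face j.succ α A) y := by
  obtain ⟨B, hB⟩ := (hasRInvertibleShell_iff _ _).1 h
  exact ⟨_, hB.face_succ hkj α⟩

theorem HasRInvertibleShell.psi {k i : Fin (m + 1)} (hki : k ≤ i) {A : C.cells (m + 2)}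
    (h : HasRInvertibleShell k.castSucc A) : HasRInvertibleShell k.castSucc (psi i A) := by
  rw [hasRInvertibleShell_iff] at h ⊢
  rw [shell_psi]
  exact Layer.exists_rInverse_psi hki h

theorem HasRInvertibleShell.psi_succ {i : Fin (m + 1)} {A : C.cells (m + 2)}
    (h : HasRInvertibleShell i.succ A) : HasRInvertibleShell i.castSucc (CubicalOmegaCat.psi i A) := by
  rw [hasRInvertibleShell_iff] at h ⊢
  rw [shell_psi]
  obtain ⟨B, hB⟩ := h
  exact (Layer.exists_rInverse_succ_iff fun α => ⟨_, hB.face_castSucc α⟩).1 ⟨B, hB⟩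

theorem RInvertible.of_psi {k i : Fin (m + 1)} (hki : k ≤ i) {A : C.cells (m + 2)}
    (hs : HasRInvertibleShell k.castSucc A) (h : RInvertible k.castSucc (CubicalOmegaCat.psi i A)) :
    RInvertible k.castSucc A := by
  rw [rInvertible_iff] at h ⊢
  rw [psi_eq] at h
  exact Layer.exists_rInverse_of_psi (L := C.layer m) hki (fun j α hkj => hs.exists_face hkj α) h

theorem RInvertible.of_psi_succ {i : Fin (m + 1)} {A : C.cells (m + 2)}
    (hs : HasRInvertibleShell i.succ A) (h : RInvertible i.castSucc (CubicalOmegaCat.psi i A)) :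
    RInvertible i.succ A := by
  rw [rInvertible_iff] at h ⊢
  rw [psi_eq] at h
  obtain ⟨B, hB⟩ := (hasRInvertibleShell_iff _ _).1 hs
  exact (Layer.exists_rInverse_succ_iff (L := C.layer m) fun α => ⟨_, hB.face_castSucc α⟩).2 h

/-- The folding applied first either keeps the direction `k` of invertibility, or lowers it by one
when `k` is the higher of its two directions. The bound `k ≤ j` is preserved, so the direction is
`0` once all foldings are used. -/
theorem RInvertible.of_psiWord (j : ℕ) (hj : j ≤ m + 1) (k : Fin (m + 2)) (hk : k.val ≤ j)
    (A : C.cells (m + 2)) (hs : HasRInvertibleShell k A) (h : RInvertible 0 (psiWord j hj A)) :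
    RInvertible k A := by
  induction j generalizing k A with
  | zero =>
    obtain rfl : k = 0 := Fin.ext (Nat.le_zero.1 hk)
    exact h
  | succ j ih =>
    rcases hk.lt_or_eq with hk' | hk'
    · obtain ⟨k, rfl⟩ : ∃ l : Fin (m + 1), k = l.castSucc := ⟨⟨k, by omega⟩, rfl⟩
      have hkj : k ≤ ⟨j, hj⟩ := Nat.le_of_lt_succ hk'
      exact .of_psi hkj hs (ih _ _ (Nat.le_of_lt_succ hk') _ (hs.psi hkj) h)
    · obtain rfl : k = Fin.succ ⟨j, hj⟩ := Fin.ext hk'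
      exact .of_psi_succ hs (ih _ (Fin.castSucc ⟨j, hj⟩) le_rfl _ hs.psi_succ h)

theorem HasRInvertibleShell.bigPsi (r : ℕ) (hr : r ≤ m + 1) {A : C.cells (m + 2)}
    (h : HasRInvertibleShell 0 A) : HasRInvertibleShell 0 (bigPsi r hr A) := by
  induction r with
  | zero => exact h
  | succ r ih => exact (ih (Nat.le_of_succ_le hr)).psi (k := 0) (Fin.zero_le _)

theorem RInvertible.of_bigPsi (r : ℕ) (hr : r ≤ m + 1) {A : C.cells (m + 2)}
    (hs : HasRInvertibleShell 0 A) (h : RInvertible 0 (bigPsi r hr A)) : RInvertible 0 A := by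
  induction r with
  | zero => exact h
  | succ r ih =>
    exact ih (Nat.le_of_succ_le hr) (.of_psi (k := 0) (Fin.zero_le _) (hs.bigPsi _ _) h)

theorem RInvertible.of_phi (r : ℕ) (hr : r ≤ m + 2) (A : C.cells (m + 2))
    (hs : HasRInvertibleShell 0 A) (h : RInvertible 0 (phi r hr A)) : RInvertible 0 A := by
  induction r generalizing A with
  | zero => exact h
  | succ r ih => exact .of_bigPsi _ _ hs (ih _ _ (hs.bigPsi _ _) h)

/-! ### Faces of folded cells. -/

theorem face_psi_gt {i : Fin m} {j : Fin (m + 1)} (hij : i.succ ≤ j) (α : Bool)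
    (A : C.cells (m + 2)) :
    C.face j.succ α (psi i.castSucc A) = psi i (C.face j.succ α A) := by
  cases m with
  | zero => exact i.elim0
  | succ m =>
  obtain ⟨j, rfl⟩ := Fin.exists_succ_eq.2 (Fin.ne_zero_of_lt (Fin.succ_pos i |>.trans_le hij))
  have hij' : i ≤ j := Fin.succ_le_succ_iff.1 hij
  have h₁ : C.face i.castSucc.succ true (C.conn i.castSucc true (C.face i.castSucc.succ false A)) =
      C.face i.castSucc.succ false A := C.face_conn_succ _ true _
  have h₂ : C.face i.castSucc.succ true (C.cmp i.castSucc.succ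
      (C.conn i.castSucc true (C.face i.castSucc.succ false A)) A) =
      C.face i.castSucc.succ false (C.conn i.castSucc false (C.face i.castSucc.succ true A)) := by
    rw [face_cmp_plus _ _ _ h₁, C.face_conn_succ]
  have e : ∀ β, C.face j.succ α (C.face i.castSucc.succ β A) =
      C.face i.succ β (C.face j.succ.succ α A) :=
    fun β => (C.face_face i.succ j.succ β α A hij).symm
  rw [psi_eq, psi_eq]
  rw [← Fin.castSucc_succ] at h₁ h₂ e ⊢
  rw [face_cmp_gt _ _ _ _ _ hij h₂, face_cmp_gt _ _ _ _ _ hij h₁,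
    C.face_conn_gt _ _ _ _ _ hij', C.face_conn_gt _ _ _ _ _ hij', e, e]

/-- On a degenerate cell the two connections become adjacent and cancel, which lowers the direction
of degeneracy by one. -/
theorem psi_deg (i : Fin n) (z : C.cells n) : psi i (C.deg i.succ z) = C.deg i.castSucc z := by
  rw [psi_eq, C.face_deg_self, C.face_deg_self, cmp_deg _ _ _ (C.face_conn_succ _ _ _),
    conn_cmp_conn_succ]

theorem psi_deg_gt {i : Fin m} {j : Fin (m + 1)} (hij : i.succ ≤ j) (z : C.cells (m + 1)) :
    psi i.castSucc (C.deg j.succ z) = C.deg j.succ (psi i z) := by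
  cases m with
  | zero => exact i.elim0
  | succ m =>
  obtain ⟨j, rfl⟩ := Fin.exists_succ_eq.2 (Fin.ne_zero_of_lt (Fin.succ_pos i |>.trans_le hij))
  have hij' : i ≤ j := Fin.succ_le_succ_iff.1 hij
  have h₁ : C.face i.succ true (C.conn i true (C.face i.succ false z)) =
      C.face i.succ false z := C.face_conn_succ _ true _
  have h₂ : C.face i.succ true (C.cmp i.succ
      (C.conn i true (C.face i.succ false z)) z) =
      C.face i.succ false (C.conn i false (C.face i.succ true z)) := by
    rw [face_cmp_plus _ _ _ h₁, C.face_conn_succ]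
  have hd : j.succ.succ.succAbove i.succ = i.succ.castSucc :=
    Fin.succAbove_of_castSucc_lt _ _ (Fin.castSucc_lt_succ_iff.2 hij)
  have e : ∀ β, C.face i.castSucc.succ β (C.deg j.succ.succ z) = C.deg j.succ (C.face i.succ β z) :=
    fun β => C.face_deg_lt i.succ j.succ β z hij
  rw [psi_eq, psi_eq, e, e, C.conn_deg_lt _ _ _ _ hij', C.conn_deg_lt _ _ _ _ hij',
    deg_cmp _ _ _ _ h₂, deg_cmp _ _ _ _ h₁, hd, Fin.castSucc_succ]

theorem face_succ_psi (i : Fin (m + 1)) (α : Bool) (A : C.cells (m + 2)) :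
    ∃ z, C.face i.succ α (psi i A) = C.deg i z := by
  have h₁ : C.face i.succ true (C.conn i true (C.face i.succ false A)) =
      C.face i.succ false A := C.face_conn_succ _ true _
  have h₂ : C.face i.succ true (C.cmp i.succ
      (C.conn i true (C.face i.succ false A)) A) =
      C.face i.succ false (C.conn i false (C.face i.succ true A)) := by
    rw [face_cmp_plus _ _ _ h₁, C.face_conn_succ]
  rw [psi_eq]
  cases α
  · rw [face_cmp_minus _ _ _ h₂, face_cmp_minus _ _ _ h₁]
    exact ⟨_, C.face_conn_succ_not i false _⟩
  · rw [face_cmp_plus _ _ _ h₂]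
    exact ⟨_, C.face_conn_succ_not i true _⟩

theorem face_psiWord (k : ℕ) (hk : k ≤ m) {j : Fin (m + 1)} (hkj : k ≤ j.val) (α : Bool)
    (A : C.cells (m + 2)) :
    C.face j.succ α (psiWord k (hk.trans m.le_succ) A) = psiWord k hk (C.face j.succ α A) := by
  induction k generalizing A with
  | zero => rfl
  | succ k ih =>
    simp only [psiWord]
    rw [ih (Nat.le_of_succ_le hk) (Nat.le_of_succ_le hkj)]
    exact congrArg _ (face_psi_gt (i := ⟨k, hk⟩) hkj α A)

theorem psiWord_deg (k : ℕ) (hk : k ≤ n) (z : C.cells n) :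
    psiWord k hk (C.deg ⟨k, Nat.lt_succ_of_le hk⟩ z) = C.deg 0 z := by
  induction k with
  | zero => rfl
  | succ k ih =>
    rw [← ih (Nat.le_of_succ_le hk)]
    exact congrArg _ (psi_deg ⟨k, hk⟩ z)

/-- The folding of index `j` makes this face degenerate in direction `j`. The foldings applied later
have smaller indices: they commute with taking the face, and then slide the degeneracy down to
direction `0`. -/
theorem face_psiWord_mem (k : ℕ) (hk : k ≤ m + 1) {j : Fin (m + 1)} (hjk : j.val < k) (α : Bool)
    (A : C.cells (m + 2)) : C.face j.succ α (psiWord k hk A) ∈ Set.range (C.deg (n := m) 0) := by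
  induction k generalizing A with
  | zero => omega
  | succ k ih =>
    rcases (Nat.lt_succ_iff.1 hjk).lt_or_eq with h | h
    · exact ih _ h _
    · obtain rfl : j = ⟨k, hk⟩ := Fin.ext h
      obtain ⟨z, hz⟩ := face_succ_psi ⟨k, hk⟩ α A
      refine ⟨z, ?_⟩
      rw [← psiWord_deg k (Nat.le_of_lt_succ hk)]
      refine Eq.trans ?_ (face_psiWord k (Nat.le_of_lt_succ hk) (j := ⟨k, hk⟩) le_rfl α _).symm
      rw [hz]

theorem face_bigPsi (r : ℕ) (hr : r ≤ m) {j : Fin (m + 1)} (hrj : r ≤ j.val) (α : Bool)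
    (A : C.cells (m + 2)) :
    C.face j.succ α (bigPsi r (hr.trans m.le_succ) A) = bigPsi r hr (C.face j.succ α A) := by
  induction r with
  | zero => rfl
  | succ r ih =>
    simp only [bigPsi]
    rw [← ih (Nat.le_of_succ_le hr) (Nat.le_of_succ_le hrj)]
    exact face_psi_gt (i := ⟨r, hr⟩) hrj α _

theorem bigPsi_deg_gt (r : ℕ) (hr : r ≤ m) {j : Fin (m + 1)} (hrj : r ≤ j.val)
    (z : C.cells (m + 1)) :
    bigPsi r (hr.trans m.le_succ) (C.deg j.succ z) = C.deg j.succ (bigPsi r hr z) := by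
  induction r with
  | zero => rfl
  | succ r ih =>
    simp only [bigPsi]
    rw [ih (Nat.le_of_succ_le hr) (Nat.le_of_succ_le hrj)]
    exact psi_deg_gt (i := ⟨r, hr⟩) hrj _

/-- The foldings in `phi r` have indices at most `r - 2`, so `r ≤ j + 1` suffices, one better than
for `bigPsi r`. -/
theorem face_phi (r : ℕ) (hr : r ≤ m + 1) {j : Fin (m + 1)} (hrj : r ≤ j.val + 1) (α : Bool)
    (A : C.cells (m + 2)) :
    C.face j.succ α (phi r (hr.trans (m + 1).le_succ) A) = phi r hr (C.face j.succ α A) := by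
  induction r generalizing A with
  | zero => rfl
  | succ r ih =>
    simp only [phi]
    rw [ih (Nat.le_of_succ_le hr) (Nat.le_of_succ_le hrj), face_bigPsi]
    omega

/-- Each `bigPsi` lowers the direction of degeneracy by one: all its foldings but the last one pass
through the degeneracy, and the last one applies `psi_deg`. -/
theorem phi_deg_mem (r : ℕ) (hr : r + 1 ≤ n + 1) (z : C.cells n) :
    phi (r + 1) hr (C.deg ⟨r, hr⟩ z) ∈ Set.range (C.deg (n := n) 0) := by
  induction r generalizing z with
  | zero => exact ⟨z, rfl⟩
  | succ r ih =>
    cases n with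
    | zero => omega
    | succ m =>
    have hr' : r < m + 1 := Nat.lt_of_succ_lt_succ hr
    have h := bigPsi_deg_gt r (Nat.le_of_lt_succ hr') (j := ⟨r, hr'⟩) le_rfl z
    have h' := psi_deg ⟨r, hr'⟩ (bigPsi r (Nat.le_of_lt_succ hr') z)
    rw [← h] at h'
    change phi (r + 1) (Nat.le_of_succ_le hr) (bigPsi (r + 1) (Nat.le_of_succ_le_succ hr) _) ∈ _
    have h'' := ih (Nat.le_of_succ_le hr) (bigPsi r (Nat.le_of_lt_succ hr') z)
    convert h'' using 2
    exact h'

/-- The last folding of `bigPsi (j + 1)` makes this face degenerate in direction `j`; the remaining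
`phi (j + 1)` commutes with the face and brings the degeneracy to direction `0`. -/
theorem face_phi_mem (r : ℕ) (hr : r ≤ m + 2) {j : Fin (m + 1)} (hjr : j.val + 1 < r) (α : Bool)
    (A : C.cells (m + 2)) : C.face j.succ α (phi r hr A) ∈ Set.range (C.deg (n := m) 0) := by
  induction r generalizing A with
  | zero => omega
  | succ r ih =>
    rcases (Nat.lt_succ_iff.1 hjr).lt_or_eq with h | h
    · exact ih _ h _
    · subst h
      change C.face j.succ α (phi (j.val + 1) (Nat.le_of_succ_le hr)
        (bigPsi (j.val + 1) (Nat.le_of_succ_le_succ hr) A)) ∈ _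
      rw [face_phi _ (Nat.lt_succ_iff.1 hr) le_rfl]
      obtain ⟨z, hz⟩ := face_succ_psi j α (bigPsi j.val (by omega) A)
      simp only [bigPsi]
      rw [hz]
      exact phi_deg_mem j.val _ z

/-- A connection in the first direction on a cell of `im ε_1` is degenerate, since `Γ_1 ε_1 = ε_1
ε_1 = ε_2 ε_1`. Hence this folding composes `A` with identities only. -/
theorem psi_zero_of_face_mem {A : C.cells (m + 2)}
    (h : ∀ α, C.face (Fin.succ 0) α A ∈ Set.range (C.deg (n := m) 0)) : psi 0 A = A := by
  have hc : ∀ α β, C.conn 0 β (C.face (Fin.succ 0) α A) =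
      C.deg (Fin.succ 0) (C.face (Fin.succ 0) α A) := fun α β => by
    obtain ⟨z, hz⟩ := h α
    rw [← hz, C.conn_deg_self, C.deg_deg _ _ _ le_rfl]
  rw [psi_eq, hc, hc, deg_cmp_self _ _ _ rfl, cmp_deg _ _ _ rfl]

/-! ### Cells with degenerate lateral faces have invertible shells. -/

theorem hasRInvertibleShell_zero (A : C.cells 1) : HasRInvertibleShell 0 A := by
  -- The shell of a 1-cell is a pair of endpoints, and its inverse is the exchanged pair.
  refine ⟨⟨fun _ α => C.face 0 (!α) A, trivial⟩, rfl, rfl, ?_, ?_⟩ <;>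
  · refine Subtype.ext (funext fun i => funext fun α => ?_)
    obtain rfl : i = 0 := Fin.ext (by omega)
    refine Eq.trans ?_ (C.face_deg_self 0 α _).symm
    cases α <;> rfl

theorem hasRInvertibleShell_of_face_mem {A : C.cells (m + 2)}
    (h : ∀ (j : Fin (m + 1)) α, C.face j.succ α A ∈ Set.range (C.deg (n := m) 0)) :
    HasRInvertibleShell 0 A := by
  choose z hz using h
  have hsame : ∀ j α β γ, C.face 0 β (C.face (Fin.succ j) α A) =
      C.face 0 γ (C.face (Fin.succ j) α A) := fun j α β γ => by
    rw [← hz, C.face_deg_self, C.face_deg_self]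
  -- The inverse shell exchanges the two faces in direction `0` and keeps the lateral ones. It is
  -- compatible because a lateral face in `im ε_1` has equal faces in direction `0`.
  let F : Fin (m + 2) → Bool → C.cells (m + 1) :=
    fun j α => Fin.cases (C.face 0 (!α) A) (fun j => C.face j.succ α A) j
  have hF : C.IsShell F := by
    intro i j α β
    refine Fin.cases (fun hij => ?_) (fun i hij => ?_) i
    · exact (hsame j β α (!α)).trans (C.face_face 0 j (!α) β A hij)
    · cases m with
      | zero => exact i.elim0
      | succ m => exact C.face_face i.succ j α β A hij
  have hs : ∀ (j : Fin (m + 1)), j.succ.succAbove 0 = 0 := fun j =>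
    Fin.succAbove_of_castSucc_lt _ _ (Fin.succ_pos j)
  have hzz : ∀ j α, C.cmp 0 (C.deg 0 (z j α)) (C.deg 0 (z j α)) = C.deg 0 (z j α) := fun j α =>
    cmp_deg _ _ _ (C.face_deg_self _ _ _)
  -- A lateral face `ε_1 z` of `A` is determined by its end `z`, so `ε_1 ∂_1^β A` has the same
  -- lateral faces as `A` for either sign `β`.
  have hd : ∀ (j : Fin (m + 1)) (α β : Bool), C.face j.succ α (C.deg 0 (C.face 0 β A)) =
      C.face j.succ α A := fun j α β => by
    refine (C.face_deg_gt j 0 α _ (Fin.zero_le _)).trans ?_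
    have := C.face_face 0 j β α A (Fin.zero_le _)
    rw [← hz, C.face_deg_self] at this
    rw [← hz, this]
    rfl
  -- Stated for two shells with the lateral faces of `A`, so as to give both composites of `A` with
  -- its inverse.
  have key : ∀ (S T : C.Shell (m + 1)) (hST : S.1 0 true = T.1 0 false) (β : Bool),
      (∀ j α, S.1 (Fin.succ j) α = C.face j.succ α A) →
      (∀ j α, T.1 (Fin.succ j) α = C.face j.succ α A) →
      S.1 0 false = C.face 0 β A → T.1 0 true = C.face 0 β A →
      C.boxCmp 0 S T = C.shell (C.deg 0 (C.face 0 β A)) := by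
    intro S T hST β hS hT hS' hT'
    refine Shell.ext fun j α => ?_
    refine Fin.cases ?_ (fun j => ?_) j
    · refine Eq.trans ?_ (C.face_deg_self 0 α _).symm
      cases α
      · rw [boxCmp_self_minus hST, hS']
      · rw [boxCmp_self_plus hST, hT']
    · refine Eq.trans ?_ (hd j α β).symm
      rw [← hs j] at hST
      have := boxCmp_succAbove α hST
      rw [hs, hS, hT, ← hz, hzz] at this
      rw [this, hz]
  rw [hasRInvertibleShell_iff]
  exact ⟨⟨F, hF⟩, rfl, rfl, key (C.shell A) ⟨F, hF⟩ rfl false (fun _ _ => rfl) (fun _ _ => rfl) rfl rfl,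
    key ⟨F, hF⟩ (C.shell A) rfl true (fun _ _ => rfl) (fun _ _ => rfl) rfl rfl⟩

theorem hasRInvertibleShell_of_face_mem_imageDegOne {A : C.cells (n + 1)}
    (h : ∀ (j : Fin (n + 1)) (α : Bool), j ≠ 0 → C.face j α A ∈ C.imageDegOne n) :
    HasRInvertibleShell 0 A := by
  cases n with
  | zero => exact hasRInvertibleShell_zero A
  | succ m => exact hasRInvertibleShell_of_face_mem fun j α => h j.succ α (Fin.succ_ne_zero j)

end CubicalOmegaCat

/-! ### The equivalences. -/

theorem proposition4p1p2 (C : CubicalOmegaCat.{u}) (n : ℕ) :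
    [ -- 1.
      ∀ A : C.cells (n + 1), CubicalOmegaCat.Invertible A,
      -- 2.
      ∀ (i : Fin (n + 1)) (A : C.cells (n + 1)),
        CubicalOmegaCat.HasRInvertibleShell i A → CubicalOmegaCat.RInvertible i A,
      -- 3.
      ∀ A : C.cells (n + 1),
        CubicalOmegaCat.HasRInvertibleShell 0 A → CubicalOmegaCat.RInvertible 0 A,
      -- 4.
      ∀ A : C.cells (n + 1),
        (∀ (j : Fin (n + 1)) (α : Bool), j ≠ 0 → C.face j α A ∈ C.imageDegOne n) →
          CubicalOmegaCat.RInvertible 0 A,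
      -- 5.
      ∀ A ∈ Set.range (CubicalOmegaCat.phi (C := C) (n + 1) (le_refl (n + 1))),
        CubicalOmegaCat.RInvertible 0 A ].TFAE ∧
    ∀ hn : 1 < n + 1,
      [ ∀ A : C.cells (n + 1), CubicalOmegaCat.Invertible A,
        -- 6.
        ∀ (i : Fin n) (A : C.cells (n + 1)),
          CubicalOmegaCat.HasTInvertibleShell i A → CubicalOmegaCat.TInvertible i A,
        -- 7.
        ∀ A : C.cells (n + 1),
          CubicalOmegaCat.HasTInvertibleShell ⟨0, Nat.lt_of_succ_lt_succ hn⟩ A →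
            CubicalOmegaCat.TInvertible ⟨0, Nat.lt_of_succ_lt_succ hn⟩ A ].TFAE := by
  have invertible_shell : (∀ A : C.cells (n + 1), CubicalOmegaCat.Invertible A) →
      ∀ (i : Fin (n + 1)) (A : C.cells (n + 1)),
      CubicalOmegaCat.HasRInvertibleShell i A → CubicalOmegaCat.RInvertible i A := by
    intro h i A hs
    cases n with
    | zero =>
      obtain rfl : i = 0 := Fin.ext (by omega)
      exact h A
    | succ m => exact .of_psiWord _ le_rfl i (Nat.le_of_lt_succ i.isLt) A hs (h A)
  have of_shell : (∀ A : C.cells (n + 1),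
      CubicalOmegaCat.HasRInvertibleShell 0 A → CubicalOmegaCat.RInvertible 0 A) →
      ∀ A : C.cells (n + 1),
        (∀ (j : Fin (n + 1)) (α : Bool), j ≠ 0 → C.face j α A ∈ C.imageDegOne n) →
          CubicalOmegaCat.RInvertible 0 A :=
    fun h A hA => h A (CubicalOmegaCat.hasRInvertibleShell_of_face_mem_imageDegOne hA)
  have of_degenerate : (∀ A : C.cells (n + 1),
      (∀ (j : Fin (n + 1)) (α : Bool), j ≠ 0 → C.face j α A ∈ C.imageDegOne n) →
        CubicalOmegaCat.RInvertible 0 A) → ∀ A : C.cells (n + 1), CubicalOmegaCat.Invertible A := by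
    intro h A
    refine h _ fun j α hj => ?_
    cases n with
    -- A 1-cell has a single direction, so the value `∅` of `imageDegOne` in dimension `0` plays no
    -- role.
    | zero => exact absurd (Fin.ext (by omega)) hj
    | succ m =>
      obtain ⟨j, rfl⟩ := Fin.exists_succ_eq.2 hj
      exact CubicalOmegaCat.face_psiWord_mem _ le_rfl j.isLt α A
  constructor
  · tfae_have 1 → 2 := invertible_shell
    tfae_have 2 → 3 := fun h => h 0
    tfae_have 3 → 4 := of_shell
    tfae_have 4 → 1 := of_degenerate
    tfae_have 4 → 5 := by
      rintro h _ ⟨A, rfl⟩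
      refine h _ fun j α hj => ?_
      cases n with
      | zero => exact absurd (Fin.ext (by omega)) hj
      | succ m =>
        obtain ⟨j, rfl⟩ := Fin.exists_succ_eq.2 hj
        exact CubicalOmegaCat.face_phi_mem _ le_rfl (Nat.succ_lt_succ j.isLt) α A
    tfae_have 5 → 3 := by
      intro h A hs
      cases n with
      | zero => exact h _ ⟨A, rfl⟩
      | succ m => exact .of_phi _ le_rfl A hs (h _ ⟨A, rfl⟩)
    tfae_finish
  · intro hn
    cases n with
    | zero => omega
    | succ m =>
    tfae_have 1 → 2 := fun h i A hs => by
      rw [CubicalOmegaCat.tInvertible_iff]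
      exact invertible_shell h _ _ ((CubicalOmegaCat.hasTInvertibleShell_iff i A).1 hs)
    tfae_have 2 → 3 := fun h => h _
    tfae_have 3 → 1 := fun h => of_degenerate fun A hA => by
      -- As `A` is its own folding, `T_1`-invertibility of `A` and of its shell mean
      -- `R_1`-invertibility.
      have hp : CubicalOmegaCat.psi 0 A = A :=
        CubicalOmegaCat.psi_zero_of_face_mem fun α => hA (Fin.succ 0) α (Fin.succ_ne_zero 0)
      have ht := h A ((CubicalOmegaCat.hasTInvertibleShell_iff _ _).2
        (hp.symm ▸ CubicalOmegaCat.hasRInvertibleShell_of_face_mem_imageDegOne hA))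
      rw [CubicalOmegaCat.tInvertible_iff] at ht
      exact hp ▸ ht
    tfae_finish
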